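/- A tree is a partial order $(T,\preceq)$ with a least element such that for every $n\in T$ the set $\{m\in T : m\preceq n\}$ is finite and linearly ordered by $\preceq$. It is computable if $T\subseteq\omega$ is a computable set and $\preceq$ is a computable relation on $T$. A self-embedding of $T$ is an injective function $f:T\to T$ such that $n\preceq m$ if and only if $f(n)\preceq f(m)$ for all $n,m\in T$; it is nontrivial if it is not onto. Theorem. Every infinite computable tree has a nontrivial self-embedding computable in $0''$, the second Turing jump of the empty set. -/

import Mathlib

/-! ### Turing functionals and the Turing jump -/

/-- The characteristic function of a set `A` of natural numbers, as an oracle. -/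
noncomputable def charFun (A : Set ℕ) : ℕ →. ℕ := fun n =>
  open Classical in Part.some (if n ∈ A then 1 else 0)

/-- Programs with an oracle. -/
inductive OracleCode : Type
  | zero : OracleCode
  | succ : OracleCode
  | left : OracleCode
  | right : OracleCode
  | oracle : OracleCode
  | pair : OracleCode → OracleCode → OracleCode
  | comp : OracleCode → OracleCode → OracleCode
  | prec : OracleCode → OracleCode → OracleCode
  | rfind : OracleCode → OracleCode

namespace OracleCode

/-- The partial function computed by a program with oracle `g`; the clauses are those of
Mathlib's `Nat.RecursiveIn {g}`. -/
def eval (g : ℕ →. ℕ) : OracleCode → ℕ →. ℕ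
  | zero => fun _ => Part.some 0
  | succ => fun n => Part.some (n + 1)
  | left => fun n => Part.some n.unpair.1
  | right => fun n => Part.some n.unpair.2
  | oracle => g
  | pair c d => fun n => Nat.pair <$> eval g c n <*> eval g d n
  | comp c d => fun n => eval g d n >>= eval g c
  | prec c d => fun p =>
      p.unpair.2.rec (eval g c p.unpair.1) fun y IH => do
        let i ← IH
        eval g d (Nat.pair p.unpair.1 (Nat.pair y i))
  | rfind c => fun a => Nat.rfind fun n => (fun m => decide (m = 0)) <$> eval g c (Nat.pair a n)

/-- The Gödel number of a program. -/
def encode : OracleCode → ℕ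
  | zero => 0
  | succ => 1
  | left => 2
  | right => 3
  | oracle => 4
  | pair c d => 4 * Nat.pair (encode c) (encode d) + 5
  | comp c d => 4 * Nat.pair (encode c) (encode d) + 6
  | prec c d => 4 * Nat.pair (encode c) (encode d) + 7
  | rfind c => 4 * encode c + 8

/-- Distinct programs have distinct Gödel numbers. -/
theorem encode_injective : Function.Injective encode := by
  intro c
  induction c with
  | pair c d ihc ihd =>
    intro e h
    cases e <;> simp only [encode] at h <;> try omega
    obtain ⟨h1, h2⟩ := Nat.pair_eq_pair.1
      (Nat.eq_of_mul_eq_mul_left four_pos (Nat.add_right_cancel h))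
    rw [ihc h1, ihd h2]
  | comp c d ihc ihd =>
    intro e h
    cases e <;> simp only [encode] at h <;> try omega
    obtain ⟨h1, h2⟩ := Nat.pair_eq_pair.1
      (Nat.eq_of_mul_eq_mul_left four_pos (Nat.add_right_cancel h))
    rw [ihc h1, ihd h2]
  | prec c d ihc ihd =>
    intro e h
    cases e <;> simp only [encode] at h <;> try omega
    obtain ⟨h1, h2⟩ := Nat.pair_eq_pair.1
      (Nat.eq_of_mul_eq_mul_left four_pos (Nat.add_right_cancel h))
    rw [ihc h1, ihd h2]
  | rfind c ihc =>
    intro e h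
    cases e <;> simp only [encode] at h <;> try omega
    rw [ihc (Nat.eq_of_mul_eq_mul_left four_pos (Nat.add_right_cancel h))]
  | _ =>
    intro e h
    cases e <;> simp only [encode] at h <;> first | rfl | omega

/-- Every natural number is the Gödel number of a program. -/
theorem encode_surjective : Function.Surjective encode := by
  intro n
  induction n using Nat.strong_induction_on with
  | _ n ih =>
    by_cases h : n < 5
    · interval_cases n
      exacts [⟨zero, rfl⟩, ⟨succ, rfl⟩, ⟨left, rfl⟩, ⟨right, rfl⟩, ⟨oracle, rfl⟩]
    · obtain ⟨k, r, hr, rfl⟩ : ∃ k r, r < 4 ∧ n = 4 * k + 5 + r :=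
        ⟨(n - 5) / 4, (n - 5) % 4, Nat.mod_lt _ (by norm_num), by omega⟩
      have hl := k.unpair_left_le
      have hr' := k.unpair_right_le
      obtain ⟨c, hc⟩ := ih k.unpair.1 (by omega)
      obtain ⟨d, hd⟩ := ih k.unpair.2 (by omega)
      obtain ⟨b, hb⟩ := ih k (by omega)
      interval_cases r
      · exact ⟨pair c d, by simp [encode, hc, hd]⟩
      · exact ⟨comp c d, by simp [encode, hc, hd]⟩
      · exact ⟨prec c d, by simp [encode, hc, hd]⟩
      · exact ⟨rfind b, by simp [encode, hb]⟩

/-- The programs with oracle `g` compute exactly the partial functions Turing reducible to `g`. -/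
theorem exists_eval_eq_iff {g f : ℕ →. ℕ} :
    (∃ c : OracleCode, c.eval g = f) ↔ Nat.RecursiveIn {g} f := by
  constructor
  · rintro ⟨c, rfl⟩
    induction c with
    | zero => exact .zero
    | succ => exact .succ
    | left => exact .left
    | right => exact .right
    | oracle => exact .oracle g rfl
    | pair c d ihc ihd => exact .pair ihc ihd
    | comp c d ihc ihd => exact .comp ihc ihd
    | prec c d ihc ihd => exact .prec ihc ihd
    | rfind c ihc => exact .rfind ihc
  · intro h
    induction h with
    | zero => exact ⟨zero, rfl⟩
    | succ => exact ⟨succ, rfl⟩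
    | left => exact ⟨left, rfl⟩
    | right => exact ⟨right, rfl⟩
    | oracle k hk => exact ⟨oracle, hk.symm⟩
    | pair _ _ ihc ihd =>
      obtain ⟨c, rfl⟩ := ihc
      obtain ⟨d, rfl⟩ := ihd
      exact ⟨pair c d, rfl⟩
    | comp _ _ ihc ihd =>
      obtain ⟨c, rfl⟩ := ihc
      obtain ⟨d, rfl⟩ := ihd
      exact ⟨comp c d, rfl⟩
    | prec _ _ ihc ihd =>
      obtain ⟨c, rfl⟩ := ihc
      obtain ⟨d, rfl⟩ := ihd
      exact ⟨prec c d, rfl⟩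
    | rfind _ ihc =>
      obtain ⟨c, rfl⟩ := ihc
      exact ⟨rfind c, rfl⟩

end OracleCode

/-- The Turing jump of `A`: the set of all `e` such that the `e`-th program with oracle `A` halts
on input `e`. -/
def turingJump (A : Set ℕ) : Set ℕ :=
  {e | ∃ c : OracleCode, c.encode = e ∧ (c.eval (charFun A) e).Dom}

/-- A map `f : T → T` on a set `T` of natural numbers, regarded as a partial function on `ℕ` with
domain `T`. -/
def toPartialFun (T : Set ℕ) (f : T → T) : ℕ →. ℕ := fun n =>
  ⟨n ∈ T, fun h => (f ⟨n, h⟩ : ℕ)⟩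

/-- `f : T → T` is computable in the set `A`. -/
def IsComputableFrom (A : Set ℕ) (T : Set ℕ) (f : T → T) : Prop :=
  TuringReducible (toPartialFun T f) (charFun A)

/-! ### Trees -/

/-- `(α, r)` is a tree: `r` is a partial order with a least element, in which every node has only
finitely many predecessors and these are linearly ordered. -/
structure IsTree {α : Type*} (r : α → α → Prop) : Prop where
  refl : ∀ a, r a a
  antisymm : ∀ a b, r a b → r b a → a = b
  trans : ∀ a b c, r a b → r b c → r a c
  exists_root : ∃ root, ∀ a, r root a
  finite_below : ∀ a, {b | r b a}.Finite
  linear_below : ∀ a b c, r b a → r c a → r b c ∨ r c b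

/-- `(T, r)` is a computable tree: a tree whose universe `T` is a computable set of natural numbers
and whose order is a computable relation on `T`. -/
structure IsComputableTree (T : Set ℕ) (r : T → T → Prop) : Prop where
  isTree : IsTree r
  computable_mem : ComputablePred fun n : ℕ => n ∈ T
  computable_rel : ComputablePred fun p : ℕ × ℕ =>
    ∃ (h₁ : p.1 ∈ T) (h₂ : p.2 ∈ T), r ⟨p.1, h₁⟩ ⟨p.2, h₂⟩

/-!
# Self-embeddings of infinite computable trees

A self-embedding of the part of a tree above a node extends by the identity to the whole tree.
Call a node infinite if there are infinitely many nodes above it. There are three cases.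

* Some node has infinitely many children that are not infinite
  (`IsComputableTreeRel.hasSigmaSelfEmbedding_of_infinite_children`). The finite trees above these
  children form an antichain of pieces `D 0, D 1, …`.
* Otherwise, if the infinite nodes above some infinite node form a chain `x 0 ≺ x 1 ≺ …`
  (`IsComputableTreeRel.hasSigmaSelfEmbedding_of_chain`), let `D i` be the finite set of the nodes
  above `x i` but not above `x (i + 1)`.
* Otherwise there are two incomparable infinite nodes above every infinite node
  (`IsComputableTreeRel.hasSigmaSelfEmbedding_of_branching`). Then there is an infinite antichain of
  infinite nodes above every infinite node, and the whole tree can be embedded above an infinite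
  node other than the root, by recursion from a node to its children.

In the first two cases Kruskal's theorem (`partiallyWellOrderedOn_finsetEmbeds`, proved by
Nash-Williams' minimal bad sequences from Higman's lemma) shows that, from some index on, each piece
embeds into infinitely many later ones. Embeddings of `D i` into pieces with strictly increasing
indices glue together with the identity elsewhere to a self-embedding missing a piece
(`IsPieceSequence.hasSigmaSelfEmbedding`).

The complexity bound is obtained by checking that the graph of the embedding is `Σ⁰₃`. The `Σ⁰ₙ`
predicates (`IsSigma`) are decidable in the `n`-th jump of the empty set (`IsSigma.decidableIn`), so
a partial function with a `Σ⁰₃` graph can be computed from `0''` by searching for a value together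
with a witness (`IsSigma.turingReducible`). The `Σ⁰₃` relations are closed under conjunction,
disjunction, bounded and existential quantification, and reflexive transitive closure, and contain
a function with a `Σ⁰₃` graph whenever they are total (`IsSigma.exists_isSigmaFun`), which provides
all choices and recursions in the constructions. That a node is infinite is `Π⁰₂`, so that both this
and its negation are `Σ⁰₃`.
-/

/-! ### The arithmetical hierarchy -/

namespace ComputablePred

variable {α : Type*} [Primcodable α] {p q : α → Prop}

protected theorem and (hp : ComputablePred p) (hq : ComputablePred q) :
    ComputablePred fun a => p a ∧ q a := by
  obtain ⟨f, hf, rfl⟩ := computable_iff.1 hp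
  obtain ⟨g, hg, rfl⟩ := computable_iff.1 hq
  exact computable_iff.2 ⟨_, Primrec.and.to_comp.comp hf hg, by ext; simp⟩

protected theorem or (hp : ComputablePred p) (hq : ComputablePred q) :
    ComputablePred fun a => p a ∨ q a :=
  (hp.not.and hq.not).not.of_eq fun a => by tauto

protected theorem comp {β : Type*} [Primcodable β] {f : β → α} (hp : ComputablePred p)
    (hf : Computable f) : ComputablePred fun b => p (f b) := by
  obtain ⟨g, hg, rfl⟩ := computable_iff.1 hp
  exact computable_iff.2 ⟨_, hg.comp hf, rfl⟩

theorem forall_lt {q : α → ℕ → Prop} {h : α → ℕ}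
    (hq : ComputablePred fun x : α × ℕ => q x.1 x.2) (hh : Computable h) :
    ComputablePred fun a => ∀ i < h a, q a i := by
  obtain ⟨g, hg, e⟩ := computable_iff.1 hq
  have e' : ∀ a i, q a i ↔ g (a, i) = true := fun a i => iff_of_eq (congrFun e (a, i))
  refine computable_iff.2 ⟨fun a => (h a).rec true fun i b => b && g (a, i),
    Computable.nat_rec hh (Computable.const true) (Computable.to₂ (Primrec.and.to_comp.comp
      (Computable.snd.comp Computable.snd)
      (hg.comp (Computable.fst.pair (Computable.fst.comp Computable.snd))))), ?_⟩
  funext a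
  refine propext ?_
  beta_reduce
  generalize h a = m
  induction m with
  | zero => simp
  | succ n ih => rw [Nat.forall_lt_succ_right, ih, e', Bool.and_eq_true]

theorem eq' {β : Type*} [Primcodable β] {f g : α → β} (hf : Computable f) (hg : Computable g) :
    ComputablePred fun a => f a = g a := by
  classical
  exact (ComputablePred.comp (p := fun x : β × β => x.1 = x.2)
    (PrimrecPred.computablePred Primrec.eq) (hf.pair hg))

theorem lt' {f g : α → ℕ} (hf : Computable f) (hg : Computable g) :
    ComputablePred fun a => f a < g a :=
  (ComputablePred.comp (p := fun x : ℕ × ℕ => x.1 < x.2)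
    (PrimrecPred.computablePred Primrec.nat_lt) (hf.pair hg))

end ComputablePred

/-- `p` is `Σ⁰ₙ`. The class `Σ⁰₀` consists of the computable predicates, and `Σ⁰ₙ₊₁` of the
projections of complements of `Σ⁰ₙ` predicates. -/
def IsSigma : ℕ → ∀ {α : Type} [Primcodable α], (α → Prop) → Prop
  | 0, _, _, p => ComputablePred p
  | n + 1, α, _, p => ∃ q : α × ℕ → Prop, IsSigma n q ∧ ∀ a, p a ↔ ∃ k, ¬ q (a, k)

namespace IsSigma

variable {α β : Type} [Primcodable α] [Primcodable β] {n : ℕ} {p q : α → Prop}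

theorem of_eq (hp : IsSigma n p) (h : ∀ a, p a ↔ q a) : IsSigma n q :=
  (funext fun a => propext (h a) : p = q) ▸ hp

protected theorem comp {f : β → α} (hp : IsSigma n p) (hf : Computable f) :
    IsSigma n fun b => p (f b) := by
  induction n generalizing α β with
  | zero => exact ComputablePred.comp hp hf
  | succ n ih =>
    obtain ⟨q, hq, e⟩ := hp
    exact ⟨fun x => q (f x.1, x.2), ih hq ((hf.comp Computable.fst).pair Computable.snd),
      fun a => e _⟩

protected theorem not (hp : IsSigma n p) : IsSigma (n + 1) fun a => ¬ p a :=
  ⟨fun x => p x.1, hp.comp Computable.fst, by simp⟩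

theorem of_computablePred (hp : ComputablePred p) : IsSigma n p := by
  induction n generalizing p with
  | zero => exact hp
  | succ n ih => exact (ih hp.not).not.of_eq fun a => not_not

theorem succ (hp : IsSigma n p) : IsSigma (n + 1) p := by
  induction n generalizing α with
  | zero => exact of_computablePred hp
  | succ n ih =>
    obtain ⟨q, hq, e⟩ := hp
    exact ⟨q, ih hq, e⟩

/-- The `i`-th entry of the list of natural numbers with code `c`, and `0` past its end. -/
def _root_.listEntry (c i : ℕ) : ℕ :=
  (((Encodable.decode (α := List ℕ) c).getD [])[i]?).getD 0

theorem _root_.computable_listEntry : Computable₂ listEntry :=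
  Computable.to₂ <| Computable.option_getD (Computable.list_getElem?.comp
    (Computable.option_getD (Computable.decode.comp Computable.fst) (Computable.const []))
    Computable.snd) (Computable.const 0)

theorem _root_.exists_listEntry_eq (w : ℕ → ℕ) (m : ℕ) : ∃ c, ∀ i < m, listEntry c i = w i :=
  ⟨Encodable.encode ((List.range m).map w), fun i hi => by simp [listEntry, hi]⟩

/-- The closure of `Σ⁰ₙ` under disjunction, conjunction and bounded quantification has to be
proved simultaneously, since each step in `n` interchanges the dual operations. -/
theorem closure (n : ℕ) : ∀ {α : Type} [Primcodable α],
    (∀ {p q : α → Prop}, IsSigma n p → IsSigma n q → IsSigma n fun a => p a ∧ q a) ∧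
    (∀ {p q : α → Prop}, IsSigma n p → IsSigma n q → IsSigma n fun a => p a ∨ q a) ∧
    (∀ {p : α × ℕ → Prop} {h : α → ℕ}, IsSigma n p → Computable h →
      IsSigma n fun a => ∀ i < h a, p (a, i)) ∧
    (∀ {p : α × ℕ → Prop} {h : α → ℕ}, IsSigma n p → Computable h →
      IsSigma n fun a => ∃ i < h a, p (a, i)) := by
  induction n with
  | zero =>
    refine fun {α _} => ⟨ComputablePred.and, ComputablePred.or,
      fun {p h} hp hh => ComputablePred.forall_lt (q := fun a i => p (a, i)) hp hh, ?_⟩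
    intro p h hp hh
    have hp' : ComputablePred fun x : α × ℕ => ¬ p x := ComputablePred.not hp
    exact (ComputablePred.forall_lt (q := fun a i => ¬ p (a, i)) hp' hh).not.of_eq
      fun a => by push Not; rfl
  | succ n ih =>
    intro α _
    have cu1 : Computable fun x : α × ℕ => x.2.unpair.1 :=
      Computable.fst.comp (Computable.unpair.comp Computable.snd)
    have cu2 : Computable fun x : α × ℕ => x.2.unpair.2 :=
      Computable.snd.comp (Computable.unpair.comp Computable.snd)
    have c1 : Computable fun x : α × ℕ => (x.1, x.2.unpair.1) := Computable.fst.pair cu1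
    have c2 : Computable fun x : α × ℕ => (x.1, x.2.unpair.2) := Computable.fst.pair cu2
    refine ⟨?_, ?_, ?_, ?_⟩
    · rintro p p' ⟨q, hq, e⟩ ⟨q', hq', e'⟩
      refine ⟨_, ih.2.1 (hq.comp c1) (hq'.comp c2), fun a => ?_⟩
      simp only [e, e']
      constructor
      · rintro ⟨⟨k, hk⟩, k', hk'⟩
        exact ⟨Nat.pair k k', by simp [hk, hk']⟩
      · rintro ⟨k, hk⟩
        push Not at hk
        exact ⟨⟨_, hk.1⟩, _, hk.2⟩
    · rintro p p' ⟨q, hq, e⟩ ⟨q', hq', e'⟩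
      refine ⟨_, ih.1 hq hq', fun a => ?_⟩
      simp only [e, e', ← exists_or]
      exact exists_congr fun k => by tauto
    · rintro p h ⟨q, hq, e⟩ hh
      have c : Computable fun x : (α × ℕ) × ℕ => ((x.1.1, x.2), listEntry x.1.2 x.2) :=
        ((Computable.fst.comp Computable.fst).pair Computable.snd).pair
          (computable_listEntry.comp (Computable.snd.comp Computable.fst) Computable.snd)
      have hh' : Computable fun x : α × ℕ => h x.1 := hh.comp Computable.fst
      refine ⟨_, ih.2.2.2 (hq.comp c) hh', fun a => ?_⟩
      simp only [e]
      push Not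
      constructor
      · intro H
        have H' : ∀ i, ∃ k, i < h a → ¬ q ((a, i), k) := fun i => by
          by_cases hi : i < h a
          · exact (H i hi).imp fun k hk _ => hk
          · exact ⟨0, fun h => absurd h hi⟩
        choose w hw using H'
        obtain ⟨l, hl⟩ := exists_listEntry_eq w (h a)
        exact ⟨l, fun i hi => by rw [hl i hi]; exact hw i hi⟩
      · exact fun ⟨k, hk⟩ i hi => ⟨_, hk i hi⟩
    · rintro p h ⟨q, hq, e⟩ hh
      have c : Computable fun x : α × ℕ => ((x.1, x.2.unpair.1), x.2.unpair.2) := c1.pair cu2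
      have hlt : ComputablePred fun x : α × ℕ => h x.1 < x.2.unpair.1 + 1 :=
        ComputablePred.lt' (hh.comp Computable.fst) (Computable.succ.comp cu1)
      refine ⟨_, ih.2.1 (of_computablePred hlt) (hq.comp c), fun a => ?_⟩
      simp only [e]
      constructor
      · rintro ⟨i, hi, k, hk⟩
        refine ⟨Nat.pair i k, ?_⟩
        simp only [Nat.unpair_pair, not_or]
        exact ⟨by omega, hk⟩
      · rintro ⟨k, hk⟩
        simp only [not_or] at hk
        exact ⟨_, by omega, _, hk.2⟩

protected theorem and (hp : IsSigma n p) (hq : IsSigma n q) : IsSigma n fun a => p a ∧ q a :=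
  (closure n).1 hp hq

protected theorem or (hp : IsSigma n p) (hq : IsSigma n q) : IsSigma n fun a => p a ∨ q a :=
  (closure n).2.1 hp hq

theorem forall_lt {p : α → ℕ → Prop} {h : α → ℕ} (hp : IsSigma n fun x : α × ℕ => p x.1 x.2)
    (hh : Computable h) : IsSigma n fun a => ∀ i < h a, p a i :=
  (closure n).2.2.1 hp hh

theorem exists_nat {p : α → ℕ → Prop} (hp : IsSigma (n + 1) fun x : α × ℕ => p x.1 x.2) :
    IsSigma (n + 1) fun a => ∃ k, p a k := by
  obtain ⟨q, hq, e⟩ := hp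
  have e' : ∀ a i, p a i ↔ ∃ k, ¬ q ((a, i), k) := fun a i => e (a, i)
  have c : Computable fun x : α × ℕ => ((x.1, x.2.unpair.1), x.2.unpair.2) :=
    (Computable.fst.pair (Computable.fst.comp (Computable.unpair.comp Computable.snd))).pair
      (Computable.snd.comp (Computable.unpair.comp Computable.snd))
  refine ⟨_, hq.comp c, fun a => ?_⟩
  simp only [e']
  exact ⟨fun ⟨i, k, h⟩ => ⟨Nat.pair i k, by simpa using h⟩, fun ⟨k, h⟩ => ⟨_, _, h⟩⟩

protected theorem ex {p : α → β → Prop} (hp : IsSigma (n + 1) fun x : α × β => p x.1 x.2) :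
    IsSigma (n + 1) fun a => ∃ b, p a b := by
  by_cases hβ : Nonempty β
  · obtain ⟨b₀⟩ := hβ
    have c : Computable fun x : α × ℕ => (x.1, (Encodable.decode (α := β) x.2).getD b₀) :=
      Computable.fst.pair (Computable.option_getD (Computable.decode.comp Computable.snd)
        (Computable.const b₀))
    refine (exists_nat (p := fun a k => p a ((Encodable.decode (α := β) k).getD b₀))
      (hp.comp c)).of_eq fun a => ?_
    exact ⟨fun ⟨k, h⟩ => ⟨_, h⟩, fun ⟨b, h⟩ => ⟨Encodable.encode b, by simpa using h⟩⟩
  · have hF : ComputablePred fun _ : α => 0 ≠ 0 :=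
      ComputablePred.not (ComputablePred.eq' (Computable.const 0) (Computable.const 0))
    refine (of_computablePred hF).of_eq fun a => ?_
    exact ⟨fun h => absurd rfl h, fun ⟨b, _⟩ => (hβ ⟨b⟩).elim⟩

protected theorem all {p : α → β → Prop} (hp : IsSigma n fun x : α × β => p x.1 x.2) :
    IsSigma (n + 2) fun a => ∀ b, p a b :=
  (IsSigma.ex (p := fun a b => ¬ p a b) hp.not).not.of_eq fun a => by push Not; rfl

end IsSigma

/-! ### Jumps decide the levels of the hierarchy -/

/-- `q` is decidable with oracle `A`. -/
def DecidableIn (A : Set ℕ) (q : ℕ → Prop) : Prop :=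
  Nat.RecursiveIn {charFun A} (charFun {n | q n})

theorem charFun_congr {A B : Set ℕ} {m n : ℕ} (h : m ∈ A ↔ n ∈ B) :
    charFun A m = charFun B n := by
  by_cases hm : m ∈ A
  · simp [charFun, hm, h.1 hm]
  · simp [charFun, hm, h.not.1 hm]

theorem mem_rfind_charFun {q : ℕ → Prop} {a k : ℕ} :
    k ∈ Nat.rfind (fun n => (fun m => decide (m = 0)) <$> charFun {n | q n} (Nat.pair a n)) ↔
      ¬ q (Nat.pair a k) ∧ ∀ m < k, q (Nat.pair a m) := by
  refine Nat.mem_rfind.trans ?_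
  simp [charFun]

theorem exists_mem_rfind_charFun {q : ℕ → Prop} {a : ℕ} (h : ∃ k, ¬ q (Nat.pair a k)) :
    ∃ k, k ∈ Nat.rfind
      (fun n => (fun m => decide (m = 0)) <$> charFun {n | q n} (Nat.pair a n)) := by
  classical
  exact ⟨Nat.find h, mem_rfind_charFun.2 ⟨Nat.find_spec h,
    fun m hm => not_not.1 (Nat.find_min h hm)⟩⟩

namespace OracleCode

/-- A program with constant value `n`. -/
def const : ℕ → OracleCode
  | 0 => zero
  | n + 1 => comp succ (const n)

theorem eval_const (g : ℕ →. ℕ) (n a : ℕ) : (const n).eval g a = Part.some n := by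
  induction n with
  | zero => rfl
  | succ n ih => simp [const, eval, ih]

theorem primrec_encode_const : Primrec fun n => (const n).encode := by
  have h : Primrec fun n : ℕ => (n.rec 0 fun _ x => 4 * Nat.pair 1 x + 6 : ℕ) := by
    refine Primrec.nat_rec₁ 0 (f := fun _ x => 4 * Nat.pair 1 x + 6) ?_
    exact Primrec.nat_add.comp (Primrec.nat_mul.comp (Primrec.const 4)
      (Primrec₂.natPair.comp (Primrec.const 1) Primrec.snd)) (Primrec.const 6)
  refine h.of_eq fun n => ?_
  induction n with
  | zero => rfl
  | succ n ih => simp only [ih, const, encode]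

theorem computable_encode_comp_const (c : OracleCode) :
    Computable fun n => (comp c (const n)).encode := by
  refine Primrec.to_comp ?_
  exact Primrec.nat_add.comp (Primrec.nat_mul.comp (Primrec.const 4)
    (Primrec₂.natPair.comp (Primrec.const c.encode) primrec_encode_const)) (Primrec.const 6)

end OracleCode

/-- The jump of `A` decides the projections of complements of predicates decidable in `A`: for
each `n`, the program searching for a `k` with `¬ q ⟨n, k⟩` ignores its input, so that it halts
on its own Gödel number exactly if such a `k` exists. -/
theorem DecidableIn.turingJump {A : Set ℕ} {q : ℕ → Prop} (hq : DecidableIn A q) :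
    DecidableIn (turingJump A) fun n => ∃ k, ¬ q (Nat.pair n k) := by
  obtain ⟨c, hc⟩ := OracleCode.exists_eval_eq_iff.2 hq
  have hmem : ∀ n, (OracleCode.comp c.rfind (OracleCode.const n)).encode ∈ _root_.turingJump A ↔
      ∃ k, ¬ q (Nat.pair n k) := by
    intro n
    have hev : (OracleCode.comp c.rfind (OracleCode.const n)).eval (charFun A)
        (OracleCode.comp c.rfind (OracleCode.const n)).encode =
        Nat.rfind fun m => (fun m => decide (m = 0)) <$> charFun {n | q n} (Nat.pair n m) := by
      rw [← hc]
      change (OracleCode.const n).eval (charFun A) _ >>= c.rfind.eval (charFun A) = _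
      rw [OracleCode.eval_const]
      exact Part.bind_some _ _
    constructor
    · rintro ⟨d, hd, hdom⟩
      obtain rfl := OracleCode.encode_injective hd
      rw [hev] at hdom
      obtain ⟨k, hk⟩ := Part.dom_iff_mem.1 hdom
      exact ⟨k, (mem_rfind_charFun.1 hk).1⟩
    · intro h
      refine ⟨_, rfl, ?_⟩
      rw [hev]
      exact Part.dom_iff_mem.2 (exists_mem_rfind_charFun h)
  have hcomp := (Nat.RecursiveIn.oracle (O := {charFun (_root_.turingJump A)}) _ rfl).comp
    (RecursiveIn.iff_nat.1 (OracleCode.computable_encode_comp_const c.rfind).computableIn)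
  refine hcomp.of_eq fun n => ?_
  refine (Part.bind_some _ _).trans ?_
  exact charFun_congr (hmem n)

theorem ComputablePred.decidableIn {p : ℕ → Prop} (hp : ComputablePred p) (A : Set ℕ) :
    DecidableIn A p := by
  classical
  have h : Computable fun n => if p n then 1 else 0 :=
    (Computable.cond hp.decide (Computable.const 1) (Computable.const 0)).of_eq fun n => by
      by_cases h : p n <;> simp [h]
  refine (RecursiveIn.iff_nat.1 h.computableIn).of_eq fun n => ?_
  simp only [charFun, Set.mem_ofPred_eq]

theorem IsSigma.decidableIn {n : ℕ} {p : ℕ → Prop} (hp : IsSigma n p) :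
    DecidableIn (turingJump^[n] ∅) p := by
  induction n generalizing p with
  | zero => exact ComputablePred.decidableIn hp _
  | succ n ih =>
    obtain ⟨q, hq, e⟩ := hp
    have hq' : IsSigma n fun m : ℕ => q m.unpair := hq.comp Computable.unpair
    rw [Function.iterate_succ_apply']
    have := (ih hq').turingJump
    simp only [Nat.unpair_pair, ← e] at this
    exact this

/-- A partial function with a `Σ⁰ₙ₊₁` graph is computable in the `n`-th jump of the empty set. -/
theorem IsSigma.turingReducible {n : ℕ} {f : ℕ →. ℕ}
    (hf : IsSigma (n + 1) fun x : ℕ × ℕ => x.2 ∈ f x.1) :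
    TuringReducible f (charFun (turingJump^[n] ∅)) := by
  obtain ⟨q, hq, e⟩ := hf
  have c : Computable fun m : ℕ =>
      ((m.unpair.1, m.unpair.2.unpair.1), m.unpair.2.unpair.2) := by
    have c2 : Computable fun m : ℕ => m.unpair.2 := Computable.snd.comp Computable.unpair
    have c3 : Computable fun m : ℕ => m.unpair.2.unpair := Computable.unpair.comp c2
    exact ((Computable.fst.comp Computable.unpair).pair (Computable.fst.comp c3)).pair
      (Computable.snd.comp c3)
  have hq' := (hq.comp c).decidableIn
  refine RecursiveIn.iff_nat.2 ((Nat.RecursiveIn.left.comp hq'.rfind).of_eq fun a => ?_)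
  refine Part.ext fun b => ?_
  simp only [Part.bind_eq_bind, Part.mem_bind_iff]
  have key : ∀ w, (∃ k, ¬ q ((a, w), k)) ↔ w ∈ f a := fun w => (e (a, w)).symm
  constructor
  · rintro ⟨w, hw, hb⟩
    have hw' := (mem_rfind_charFun.1 hw).1
    simp only [Nat.unpair_pair] at hw'
    obtain rfl := Part.mem_some_iff.1 hb
    exact (key _).1 ⟨_, hw'⟩
  · intro hb
    obtain ⟨k, hk⟩ := (key b).2 hb
    obtain ⟨w, hw⟩ := exists_mem_rfind_charFun (a := a)
      (q := fun m => q ((m.unpair.1, m.unpair.2.unpair.1), m.unpair.2.unpair.2))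
      ⟨Nat.pair b k, by simpa using hk⟩
    refine ⟨w, hw, ?_⟩
    have hw' := (mem_rfind_charFun.1 hw).1
    simp only [Nat.unpair_pair] at hw'
    have := (key _).1 ⟨_, hw'⟩
    exact Part.mem_some_iff.2 (Part.mem_unique hb this)

/-! ### Kruskal's theorem for finite pieces of a forest -/

/-- `φ` matches the entries of a list with distinct entries of another one. -/
theorem List.SublistForall₂.exists_injOn {β : Type*} {R : β → β → Prop} {l₁ l₂ : List β}
    (h : List.SublistForall₂ R l₁ l₂) (h₁ : l₁.Nodup) (h₂ : l₂.Nodup) :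
    ∃ φ : β → β, Set.InjOn φ {x | x ∈ l₁} ∧ ∀ x ∈ l₁, φ x ∈ l₂ ∧ R x (φ x) := by
  classical
  induction h with
  | nil => exact ⟨id, by simp, by simp⟩
  | @cons a b l₁ l₂ hab _ ih =>
    rw [List.nodup_cons] at h₁ h₂
    obtain ⟨φ, hφ, hφ'⟩ := ih h₁.2 h₂.2
    have hne : ∀ x ∈ l₁, x ≠ a := fun x hx h => h₁.1 (h ▸ hx)
    refine ⟨Function.update φ a b, ?_, ?_⟩
    · intro x hx y hy hxy
      rcases List.mem_cons.1 (show x ∈ _ from hx) with rfl | hx' <;>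
        rcases List.mem_cons.1 (show y ∈ _ from hy) with rfl | hy'
      · rfl
      · rw [Function.update_self, Function.update_of_ne (hne y hy')] at hxy
        exact absurd (hxy ▸ (hφ' y hy').1) h₂.1
      · rw [Function.update_self, Function.update_of_ne (hne x hx')] at hxy
        exact absurd (hxy ▸ (hφ' x hx').1) h₂.1
      · rw [Function.update_of_ne (hne x hx'), Function.update_of_ne (hne y hy')] at hxy
        exact hφ hx' hy' hxy
    · intro x hx
      rcases List.mem_cons.1 hx with rfl | hx
      · simpa using hab
      · rw [Function.update_of_ne (hne x hx)]
        exact ⟨List.mem_cons_of_mem _ (hφ' x hx).1, (hφ' x hx).2⟩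
  | cons_right _ ih =>
    rw [List.nodup_cons] at h₂
    obtain ⟨φ, hφ, hφ'⟩ := ih h₁ h₂.2
    exact ⟨φ, hφ, fun x hx => ⟨List.mem_cons_of_mem _ (hφ' x hx).1, (hφ' x hx).2⟩⟩

/-- `r` is a partial order in which the predecessors of every element are linearly ordered. -/
structure IsForestOrder {α : Type*} (r : α → α → Prop) : Prop where
  refl : ∀ a, r a a
  antisymm : ∀ a b, r a b → r b a → a = b
  trans : ∀ a b c, r a b → r b c → r a c
  linear_below : ∀ a b c, r b a → r c a → r b c ∨ r c b

/-- `(D, r)` embeds into `(E, r)`, the finite sets `D` and `E` being ordered by `r`. -/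
def FinsetEmbeds {α : Type*} (r : α → α → Prop) (D E : Finset α) : Prop :=
  ∃ e : α → α, (∀ a ∈ D, e a ∈ E) ∧ ∀ a ∈ D, ∀ b ∈ D, r a b ↔ r (e a) (e b)

/-- `D` is a finite set of nodes with least element `ρ`. -/
def IsRootedAt {α : Type*} (r : α → α → Prop) (D : Finset α) (ρ : α) : Prop :=
  ρ ∈ D ∧ ∀ a ∈ D, r ρ a

namespace FinsetEmbeds

variable {α : Type*} {r : α → α → Prop} {D E F : Finset α}

theorem rfl' : FinsetEmbeds r D D := ⟨id, fun _ h => h, fun _ _ _ _ => Iff.rfl⟩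

theorem trans' : FinsetEmbeds r D E → FinsetEmbeds r E F → FinsetEmbeds r D F := by
  rintro ⟨e, h, h'⟩ ⟨f, k, k'⟩
  exact ⟨f ∘ e, fun a ha => k _ (h a ha), fun a ha b hb =>
    (h' a ha b hb).trans (k' _ (h a ha) _ (h b hb))⟩

theorem of_subset (h : D ⊆ E) : FinsetEmbeds r D E :=
  ⟨id, fun _ ha => h ha, fun _ _ _ _ => Iff.rfl⟩

instance : IsPreorder (Finset α) (FinsetEmbeds r) where
  refl _ := rfl'
  trans _ _ _ := trans'

end FinsetEmbeds

section Kruskal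

variable {α : Type*} {r : α → α → Prop} {D E : Finset α} {ρ σ : α}

open Classical in
/-- The branches of `D` above its least element `ρ`: the sets `{a ∈ D : m ⪯ a}`, for `m` minimal
in `D \ {ρ}`. -/
noncomputable def branches (r : α → α → Prop) (D : Finset α) (ρ : α) : Finset (Finset α) :=
  ((D.erase ρ).filter fun m => ∀ a ∈ D.erase ρ, r a m → a = m).image
    fun m => D.filter fun a => r m a

theorem mem_branches {C : Finset α} : C ∈ branches r D ρ ↔ ∃ m, (m ∈ D ∧ m ≠ ρ) ∧
    (∀ a ∈ D, a ≠ ρ → r a m → a = m) ∧ ∀ a, a ∈ C ↔ a ∈ D ∧ r m a := by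
  classical
  simp only [branches, Finset.mem_image, Finset.mem_filter, Finset.mem_erase]
  refine exists_congr fun m => ?_
  rw [Finset.ext_iff]
  simp only [Finset.mem_filter]
  constructor
  · rintro ⟨⟨h, h'⟩, e⟩
    exact ⟨⟨h.2, h.1⟩, fun a ha hne => h' a ⟨hne, ha⟩, fun a => (e a).symm⟩
  · rintro ⟨h, h', e⟩
    exact ⟨⟨⟨h.2, h.1⟩, fun a ha => h' a ha.2 ha.1⟩, fun a => (e a).symm⟩

theorem branches_subset {C : Finset α} (hC : C ∈ branches r D ρ) : C ⊆ D := by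
  obtain ⟨m, -, -, h⟩ := mem_branches.1 hC
  exact fun a ha => ((h a).1 ha).1

theorem root_notMem_branches (ht : IsForestOrder r) (hD : IsRootedAt r D ρ) {C : Finset α}
    (hC : C ∈ branches r D ρ) : ρ ∉ C := by
  obtain ⟨m, hm, -, h⟩ := mem_branches.1 hC
  exact fun hρ => hm.2 (ht.antisymm _ _ ((h ρ).1 hρ).2 (hD.2 m hm.1))

theorem exists_isRootedAt_of_mem_branches (ht : IsForestOrder r) {C : Finset α}
    (hC : C ∈ branches r D ρ) : ∃ m, IsRootedAt r C m := by
  obtain ⟨m, hm, -, h⟩ := mem_branches.1 hC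
  exact ⟨m, (h m).2 ⟨hm.1, ht.refl m⟩, fun a ha => ((h a).1 ha).2⟩

theorem card_lt_of_mem_branches (ht : IsForestOrder r) (hD : IsRootedAt r D ρ) {C : Finset α}
    (hC : C ∈ branches r D ρ) : C.card < D.card :=
  Finset.card_lt_card (Finset.ssubset_iff_subset_ne.2 ⟨branches_subset hC, fun h =>
    root_notMem_branches ht hD hC (h ▸ hD.1)⟩)

theorem exists_mem_branches (ht : IsForestOrder r) {a : α} (ha : a ∈ D) (hne : a ≠ ρ) :
    ∃ C ∈ branches r D ρ, a ∈ C := by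
  classical
  suffices ∃ m, (m ∈ D ∧ m ≠ ρ) ∧ (∀ b ∈ D, b ≠ ρ → r b m → b = m) ∧ r m a by
    obtain ⟨m, hm, hmin, hma⟩ := this
    exact ⟨D.filter fun a => r m a, mem_branches.2 ⟨m, hm, hmin, by simp⟩, by simp [ha, hma]⟩
  -- among the nodes of `D \ {ρ}` below `a`, take one with the fewest elements of `D` below it
  obtain ⟨m, hm, hmin⟩ := Finset.exists_min_image (D.filter fun b => b ≠ ρ ∧ r b a)
    (fun b => (D.filter fun c => r c b).card) ⟨a, by simp [ha, hne, ht.refl]⟩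
  simp only [Finset.mem_filter] at hm hmin
  refine ⟨m, ⟨hm.1, hm.2.1⟩, fun b hb hbρ hbm => ?_, hm.2.2⟩
  by_contra hbm'
  have h := hmin b ⟨hb, hbρ, ht.trans _ _ _ hbm hm.2.2⟩
  refine absurd h (not_le.2 (Finset.card_lt_card (Finset.ssubset_iff_subset_ne.2 ⟨?_, ?_⟩)))
  · intro c hc
    simp only [Finset.mem_filter] at hc ⊢
    exact ⟨hc.1, ht.trans _ _ _ hc.2 hbm⟩
  · intro heq
    have : m ∈ D.filter fun c => r c b := heq ▸ by simp [hm.1, ht.refl]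
    exact hbm' (ht.antisymm _ _ hbm (Finset.mem_filter.1 this).2)

theorem branches_eq_of_rel (ht : IsForestOrder r) {C C' : Finset α} (hC : C ∈ branches r D ρ)
    (hC' : C' ∈ branches r D ρ) {a b : α} (ha : a ∈ C) (hb : b ∈ C') (hab : r a b) : C = C' := by
  obtain ⟨m, hm, hmin, h⟩ := mem_branches.1 hC
  obtain ⟨m', hm', hmin', h'⟩ := mem_branches.1 hC'
  have hmb := ht.trans _ _ _ ((h a).1 ha).2 hab
  have hmm : m = m' := by
    rcases ht.linear_below _ _ _ hmb ((h' b).1 hb).2 with hl | hl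
    · exact hmin' m hm.1 hm.2 hl
    · exact (hmin m' hm'.1 hm'.2 hl).symm
  ext c
  rw [h, h', hmm]

/-- Embeddings of the branches of `D` into distinct branches of `E` combine to an embedding. -/
theorem FinsetEmbeds.of_branches (ht : IsForestOrder r) (hD : IsRootedAt r D ρ)
    (hE : IsRootedAt r E σ)
    (h : List.SublistForall₂ (FinsetEmbeds r) (branches r D ρ).toList (branches r E σ).toList) :
    FinsetEmbeds r D E := by
  classical
  obtain ⟨φ, hφ, hφ'⟩ := h.exists_injOn (Finset.nodup_toList _) (Finset.nodup_toList _)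
  simp only [Finset.mem_toList] at hφ hφ'
  have hbr : ∀ a, ∃ C, a ∈ D → a ≠ ρ → C ∈ branches r D ρ ∧ a ∈ C := fun a => by
    by_cases h : a ∈ D ∧ a ≠ ρ
    · exact (exists_mem_branches ht h.1 h.2).imp fun C hC _ _ => hC
    · exact ⟨∅, fun h1 h2 => absurd ⟨h1, h2⟩ h⟩
  choose B hB using hbr
  have hem : ∀ C, ∃ e : α → α, C ∈ branches r D ρ → (∀ a ∈ C, e a ∈ φ C) ∧
      ∀ a ∈ C, ∀ b ∈ C, r a b ↔ r (e a) (e b) := fun C => by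
    by_cases h : C ∈ branches r D ρ
    · exact (hφ' C h).2.imp fun e he _ => he
    · exact ⟨id, fun h' => absurd h' h⟩
  choose e he using hem
  have hmem : ∀ a ∈ D, a ≠ ρ → e (B a) a ∈ φ (B a) := fun a ha hne =>
    (he _ (hB a ha hne).1).1 a (hB a ha hne).2
  have hsub : ∀ a ∈ D, a ≠ ρ → φ (B a) ∈ branches r E σ := fun a ha hne =>
    (hφ' _ (hB a ha hne).1).1
  refine ⟨fun a => if a = ρ then σ else e (B a) a, fun a ha => ?_, fun a ha b hb => ?_⟩
  · by_cases hne : a = ρ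
    · simpa [hne] using hE.1
    · simpa [hne] using branches_subset (hsub a ha hne) (hmem a ha hne)
  · by_cases hna : a = ρ
    · subst hna
      refine iff_of_true (hD.2 b hb) ?_
      by_cases hnb : b = a
      · simpa [hnb] using ht.refl σ
      · simpa [hnb] using hE.2 _ (branches_subset (hsub b hb hnb) (hmem b hb hnb))
    · by_cases hnb : b = ρ
      · subst hnb
        refine iff_of_false (fun h => hna (ht.antisymm _ _ h (hD.2 a ha))) ?_
        simp only [hna, if_false, if_true]
        intro h
        refine root_notMem_branches ht hE (hsub a ha hna) ?_
        rw [ht.antisymm _ _ (hE.2 _ (branches_subset (hsub a ha hna) (hmem a ha hna))) h]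
        exact hmem a ha hna
      · simp only [hna, hnb, if_false]
        by_cases hBB : B a = B b
        · rw [← hBB]
          exact (he _ (hB a ha hna).1).2 a (hB a ha hna).2 b (hBB ▸ (hB b hb hnb).2)
        · refine iff_of_false (fun h => hBB (branches_eq_of_rel ht (hB a ha hna).1
            (hB b hb hnb).1 (hB a ha hna).2 (hB b hb hnb).2 h)) fun h => hBB ?_
          exact hφ (hB a ha hna).1 (hB b hb hnb).1 (branches_eq_of_rel ht (hsub a ha hna)
            (hsub b hb hnb) (hmem a ha hna) (hmem b hb hnb) h)

/-- Kruskal's tree theorem, for the finite subsets with a least element of a forest. -/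
theorem partiallyWellOrderedOn_finsetEmbeds (ht : IsForestOrder r) :
    {D : Finset α | ∃ ρ, IsRootedAt r D ρ}.PartiallyWellOrderedOn (FinsetEmbeds r) := by
  classical
  rw [Set.PartiallyWellOrderedOn.iff_not_exists_isMinBadSeq Finset.card]
  rintro ⟨f, hbad, hmin⟩
  choose ρ hρ using hbad.1
  have hpwo : {C : Finset α | ∃ n, C ∈ branches r (f n) (ρ n)}.PartiallyWellOrderedOn
      (FinsetEmbeds r) := by
    rw [Set.PartiallyWellOrderedOn.iff_forall_not_isBadSeq]
    rintro g ⟨hg, hg'⟩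
    choose N hN using hg
    -- a bad sequence of branches can be started at the term with the least index, and
    -- then prefixed by the terms of `f` before that index
    obtain ⟨m, hm⟩ : ∃ m, ∀ k, N m ≤ N k :=
      ⟨Function.argmin N, fun k => Function.argmin_le N k⟩
    refine hmin (N m) (fun n => if n < N m then f n else g (n - N m + m))
      (fun k hk => by simp [hk]) ?_ ⟨fun n => ?_, fun i j hij => ?_⟩
    · simpa using card_lt_of_mem_branches ht (hρ _) (hN m)
    · by_cases hn : n < N m
      · simpa [hn] using ⟨_, hρ n⟩
      · simpa [hn] using exists_isRootedAt_of_mem_branches ht (hN _)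
    · by_cases hi : i < N m
      · by_cases hj : j < N m
        · simpa [hi, hj] using hbad.2 i j hij
        · simp only [hi, hj, if_true, if_false]
          intro h
          have := hm (j - N m + m)
          exact hbad.2 i _ (by omega) (h.trans' (FinsetEmbeds.of_subset
            (branches_subset (hN (j - N m + m)))))
      · have hj : ¬ j < N m := by omega
        simp only [hi, hj, if_false]
        exact hg' _ _ (by omega)
  obtain ⟨i, j, hij, h⟩ := (hpwo.partiallyWellOrderedOn_sublistForall₂ _).exists_lt
    (f := fun n => (branches r (f n) (ρ n)).toList) (fun n C hC => ⟨n, Finset.mem_toList.1 hC⟩)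
  exact hbad.2 i j hij (FinsetEmbeds.of_branches ht (hρ i) (hρ j) h)

/-- An embedding of rooted finite sets can be chosen to preserve the roots. -/
theorem FinsetEmbeds.exists_root_preserving (ht : IsForestOrder r) (hD : IsRootedAt r D ρ)
    (hE : IsRootedAt r E σ) (h : FinsetEmbeds r D E) : ∃ e : α → α, (∀ a ∈ D, e a ∈ E) ∧
      (∀ a ∈ D, e a = σ ↔ a = ρ) ∧ ∀ a ∈ D, ∀ b ∈ D, r a b ↔ r (e a) (e b) := by
  classical
  obtain ⟨e, he, he'⟩ := h
  have hne : ∀ a ∈ D, a ≠ ρ → e a ≠ σ := by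
    intro a ha hne heq
    refine hne (ht.antisymm _ _ ((he' a ha ρ hD.1).2 ?_) (hD.2 a ha))
    rw [heq]
    exact hE.2 _ (he ρ hD.1)
  refine ⟨fun a => if a = ρ then σ else e a, fun a ha => ?_, fun a ha => ?_, fun a ha b hb => ?_⟩
  · by_cases h : a = ρ
    · simpa [h] using hE.1
    · simpa [h] using he a ha
  · by_cases h : a = ρ
    · simp [h]
    · simpa [h] using hne a ha h
  · by_cases hna : a = ρ
    · subst hna
      refine iff_of_true (hD.2 b hb) ?_
      by_cases hnb : b = a
      · simpa [hnb] using ht.refl σ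
      · simpa [hnb] using hE.2 _ (he b hb)
    · by_cases hnb : b = ρ
      · subst hnb
        refine iff_of_false (fun h => hna (ht.antisymm _ _ h (hD.2 a ha))) ?_
        simp only [hna, if_false, if_true]
        exact fun h => hne a ha hna (ht.antisymm _ _ h (hE.2 _ (he a ha)))
      · simpa [hna, hnb] using he' a ha b hb

/-- In a sequence of finite rooted sets, every term from some index on embeds into infinitely
many later ones. -/
theorem exists_forall_finsetEmbeds (ht : IsForestOrder r) {D : ℕ → Finset α} {ρ : ℕ → α}
    (hD : ∀ i, IsRootedAt r (D i) (ρ i)) :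
    ∃ k, ∀ i ≥ k, ∀ m, ∃ j > m, FinsetEmbeds r (D i) (D j) := by
  by_contra! hcon
  choose g hg hg' using hcon
  obtain ⟨ψ, hψ, hψ'⟩ := Nat.exists_strictMono_subsequence
    (P := fun i => ∃ m, ∀ j > m, ¬ FinsetEmbeds r (D i) (D j))
    fun N => ⟨_, hg (N + 1), hg' (N + 1)⟩
  obtain ⟨φ, hφ⟩ := (partiallyWellOrderedOn_finsetEmbeds ht).exists_monotone_subseq
    (f := fun n => D (ψ n)) (fun n => ⟨_, hD _⟩)
  obtain ⟨m, hm⟩ := hψ' (φ 0)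
  exact hm _ ((Nat.lt_succ_self m).trans_le ((hψ.comp φ.strictMono).le_apply))
    (hφ 0 (m + 1) (Nat.zero_le _))

end Kruskal

/-! ### Functions with `Σ⁰ₙ` graphs -/

theorem computable_decode_getD {β : Type*} [Primcodable β] (b₀ : β) :
    Computable fun k : ℕ => (Encodable.decode (α := β) k).getD b₀ :=
  Computable.option_getD Computable.decode (Computable.const b₀)

/-- `f` has a `Σ⁰ₙ` graph. -/
def IsSigmaFun (n : ℕ) {α β : Type} [Primcodable α] [Primcodable β] (f : α → β) : Prop :=
  IsSigma n fun x : α × β => f x.1 = x.2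

namespace IsSigmaFun

variable {α β γ : Type} [Primcodable α] [Primcodable β] [Primcodable γ] {n : ℕ}

theorem of_computable {f : α → β} (hf : Computable f) : IsSigmaFun n f :=
  IsSigma.of_computablePred (ComputablePred.eq' (hf.comp Computable.fst) Computable.snd)

/-- Substitution of functions with `Σ⁰ₙ₊₁` graphs into `Σ⁰ₙ₊₁` predicates. -/
theorem subst {f : α → β} {p : β → Prop} (hp : IsSigma (n + 1) p) (hf : IsSigmaFun (n + 1) f) :
    IsSigma (n + 1) fun a => p (f a) :=
  (IsSigma.ex (p := fun a b => f a = b ∧ p b) (hf.and (hp.comp Computable.snd))).of_eq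
    fun a => by simp

protected theorem pair {f : α → β} {g : α → γ} (hf : IsSigmaFun n f) (hg : IsSigmaFun n g) :
    IsSigmaFun n fun a => (f a, g a) := by
  have h₁ : IsSigma n fun x : α × β × γ => f x.1 = x.2.1 :=
    hf.comp (Computable.fst.pair (Computable.fst.comp Computable.snd))
  have h₂ : IsSigma n fun x : α × β × γ => g x.1 = x.2.2 :=
    hg.comp (Computable.fst.pair (Computable.snd.comp Computable.snd))
  exact (h₁.and h₂).of_eq fun x => by simp [Prod.ext_iff]

protected theorem comp {g : β → γ} {f : α → β} (hg : IsSigmaFun (n + 1) g)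
    (hf : IsSigmaFun (n + 1) f) : IsSigmaFun (n + 1) fun a => g (f a) := by
  have h : IsSigmaFun (n + 1) fun x : α × γ => (f x.1, x.2) := by
    have h₁ : IsSigmaFun (n + 1) fun x : α × γ => f x.1 := by
      have c : Computable fun x : (α × γ) × β => (x.1.1, x.2) :=
        (Computable.fst.comp Computable.fst).pair Computable.snd
      exact IsSigma.comp hf c
    exact h₁.pair (of_computable Computable.snd)
  exact subst hg h

end IsSigmaFun

theorem reflTransGen_iff_exists_seq {β : Type*} {R : β → β → Prop} {x y : β} :
    Relation.ReflTransGen R x y ↔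
      ∃ (m : ℕ) (w : ℕ → β), w 0 = x ∧ w m = y ∧ ∀ i < m, R (w i) (w (i + 1)) := by
  constructor
  · intro h
    induction h with
    | refl => exact ⟨0, fun _ => x, rfl, rfl, by simp⟩
    | @tail y z _ hyz ih =>
      obtain ⟨m, w, h0, hm, hw⟩ := ih
      refine ⟨m + 1, fun i => if i ≤ m then w i else z, by simp [h0], by simp, fun i hi => ?_⟩
      rcases Nat.lt_succ_iff_lt_or_eq.1 hi with hi | rfl
      · simpa [hi.le, Nat.succ_le_of_lt hi] using hw i hi
      · simpa [hm] using hyz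
  · rintro ⟨m, w, rfl, rfl, hw⟩
    induction m with
    | zero => exact .refl
    | succ m ih => exact (ih fun i hi => hw i (by omega)).tail (hw m (by omega))

section

variable {α β : Type} [Primcodable α] [Primcodable β] {n : ℕ}

/-- Uniformization: a total `Σ⁰ₙ₊₁` relation contains a function with a `Σ⁰ₙ₊₁` graph. -/
theorem IsSigma.exists_isSigmaFun [Inhabited β] {p : α → β → Prop}
    (hp : IsSigma (n + 1) fun x : α × β => p x.1 x.2) (htot : ∀ a, ∃ b, p a b) :
    ∃ f : α → β, IsSigmaFun (n + 1) f ∧ ∀ a, p a (f a) := by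
  classical
  obtain ⟨q, hq, e⟩ := hp
  let dec : ℕ → β := fun k => (Encodable.decode (α := β) k.unpair.1).getD default
  have hdec : Computable dec :=
    (computable_decode_getD default).comp (Computable.fst.comp Computable.unpair)
  have hex : ∀ a, ∃ k : ℕ, ¬ q ((a, dec k), k.unpair.2) := fun a => by
    obtain ⟨b, hb⟩ := htot a
    obtain ⟨k, hk⟩ := (e (a, b)).1 hb
    exact ⟨Nat.pair (Encodable.encode b) k, by simpa [dec] using hk⟩
  refine ⟨fun a => dec (Nat.find (hex a)), ?_, fun a => (e _).2 ⟨_, Nat.find_spec (hex a)⟩⟩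
  have c : Computable fun x : α × ℕ => ((x.1, dec x.2), x.2.unpair.2) :=
    (Computable.fst.pair (hdec.comp Computable.snd)).pair
      (Computable.snd.comp (Computable.unpair.comp Computable.snd))
  have hq₁ : IsSigma n fun x : α × ℕ => q ((x.1, dec x.2), x.2.unpair.2) := hq.comp c
  have c' : Computable fun x : (α × ℕ) × ℕ => (x.1.1, x.2) :=
    (Computable.fst.comp Computable.fst).pair Computable.snd
  have hq₂ : IsSigma n fun x : (α × ℕ) × ℕ => q ((x.1.1, dec x.2), x.2.unpair.2) := hq₁.comp c'
  have hq₃ : IsSigma n fun x : α × ℕ => ∀ i < x.2, q ((x.1, dec i), i.unpair.2) :=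
    IsSigma.forall_lt (p := fun (x : α × ℕ) i => q ((x.1, dec i), i.unpair.2)) hq₂ Computable.snd
  have hfind : IsSigma (n + 1) fun x : α × ℕ => Nat.find (hex x.1) = x.2 :=
    (hq₁.not.and hq₃.succ).of_eq fun x => by
      rw [Nat.find_eq_iff]
      simp only [not_not]
  exact (IsSigmaFun.of_computable hdec).comp hfind

/-- The reflexive transitive closure of a `Σ⁰ₙ₊₁` relation is `Σ⁰ₙ₊₁`, as a finite path can be
coded by a number. -/
theorem IsSigma.reflTransGen {R : β → β → Prop}
    (hR : IsSigma (n + 1) fun x : β × β => R x.1 x.2) :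
    IsSigma (n + 1) fun x : β × β => Relation.ReflTransGen R x.1 x.2 := by
  by_cases hβ : Nonempty β
  swap
  · exact hR.of_eq fun x => (hβ ⟨x.1⟩).elim
  obtain ⟨b₀⟩ := hβ
  let dec : ℕ → ℕ → β := fun c i => (Encodable.decode (α := β) (listEntry c i)).getD b₀
  have hdec : Computable₂ dec := (computable_decode_getD b₀).comp₂ computable_listEntry
  have h₁ : IsSigma (n + 1) fun x : (β × β) × ℕ × ℕ => dec x.2.2 0 = x.1.1 :=
    .of_computablePred (.eq' (hdec.comp (Computable.snd.comp Computable.snd) (Computable.const 0))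
      (Computable.fst.comp Computable.fst))
  have h₂ : IsSigma (n + 1) fun x : (β × β) × ℕ × ℕ => dec x.2.2 x.2.1 = x.1.2 :=
    .of_computablePred (.eq' (hdec.comp (Computable.snd.comp Computable.snd)
      (Computable.fst.comp Computable.snd)) (Computable.snd.comp Computable.fst))
  have h₃ : IsSigma (n + 1) fun x : (β × β) × ℕ × ℕ =>
      ∀ i < x.2.1, R (dec x.2.2 i) (dec x.2.2 (i + 1)) := by
    have cc : Computable fun x : ((β × β) × ℕ × ℕ) × ℕ => x.1.2.2 :=
      Computable.snd.comp (Computable.snd.comp Computable.fst)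
    have c : Computable fun x : ((β × β) × ℕ × ℕ) × ℕ =>
        (dec x.1.2.2 x.2, dec x.1.2.2 (x.2 + 1)) :=
      (hdec.comp cc Computable.snd).pair (hdec.comp cc (Computable.succ.comp Computable.snd))
    exact IsSigma.forall_lt (p := fun (x : (β × β) × ℕ × ℕ) i =>
      R (dec x.2.2 i) (dec x.2.2 (i + 1))) (hR.comp c) (Computable.fst.comp Computable.snd)
  refine (IsSigma.ex (p := fun (x : β × β) (y : ℕ × ℕ) => dec y.2 0 = x.1 ∧ dec y.2 y.1 = x.2 ∧
    ∀ i < y.1, R (dec y.2 i) (dec y.2 (i + 1))) (h₁.and (h₂.and h₃))).of_eq fun x => ?_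
  rw [reflTransGen_iff_exists_seq]
  constructor
  · rintro ⟨⟨m, c⟩, h⟩
    exact ⟨m, dec c, h⟩
  · rintro ⟨m, w, h0, hm, hw⟩
    obtain ⟨c, hc⟩ := exists_listEntry_eq (fun i => Encodable.encode (w i)) (m + 1)
    have hc' : ∀ i < m + 1, dec c i = w i := fun i hi => by simp [dec, hc i hi]
    refine ⟨(m, c), ?_, ?_, fun i hi => ?_⟩
    · rw [hc' 0 (by omega), h0]
    · rw [hc' m (by omega), hm]
    · rw [hc' i (by omega), hc' (i + 1) (by omega)]
      exact hw i hi

/-- Functions with `Σ⁰ₙ₊₁` graphs are closed under primitive recursion. -/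
theorem IsSigmaFun.nat_rec {F : α → ℕ → β} {f : α → β} {g : α × ℕ × β → β}
    (hf : IsSigmaFun (n + 1) f) (hg : IsSigmaFun (n + 1) g) (h0 : ∀ a, F a 0 = f a)
    (hs : ∀ a i, F a (i + 1) = g (a, i, F a i)) :
    IsSigmaFun (n + 1) fun x : α × ℕ => F x.1 x.2 := by
  let R : α × ℕ × β → α × ℕ × β → Prop := fun x y => (x.1, x.2.1 + 1, g x) = y
  have hR : IsSigma (n + 1) fun x : (α × ℕ × β) × α × ℕ × β => R x.1 x.2 := by
    have h₁ : IsSigmaFun (n + 1) fun x : α × ℕ × β => (x.1, x.2.1 + 1, g x) :=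
      (of_computable Computable.fst).pair
        ((of_computable (Computable.succ.comp (Computable.fst.comp Computable.snd))).pair hg)
    exact h₁
  have key : ∀ a i b, F a i = b ↔ Relation.ReflTransGen R (a, 0, f a) (a, i, b) := by
    intro a i b
    constructor
    · rintro rfl
      induction i with
      | zero => rw [h0]
      | succ i ih => exact ih.tail (by simp only [R, hs])
    · intro h
      suffices ∀ y, Relation.ReflTransGen R (a, 0, f a) y → y.1 = a ∧ F a y.2.1 = y.2.2 from
        (this _ h).2
      intro y hy
      induction hy with
      | refl => exact ⟨rfl, h0 a⟩
      | @tail y z _ hyz ih =>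
        obtain ⟨a', i', b'⟩ := y
        obtain ⟨rfl, ih⟩ := ih
        dsimp only at ih
        subst ih
        obtain rfl : _ = z := hyz
        exact ⟨rfl, hs _ _⟩
  have h₂ : IsSigmaFun (n + 1) fun x : (α × ℕ) × β =>
      (((x.1.1, 0, f x.1.1), (x.1.1, x.1.2, x.2)) : (α × ℕ × β) × α × ℕ × β) := by
    have ca : Computable fun x : (α × ℕ) × β => x.1.1 := Computable.fst.comp Computable.fst
    have ci : Computable fun x : (α × ℕ) × β => x.1.2 := Computable.snd.comp Computable.fst
    exact ((of_computable ca).pair ((of_computable (Computable.const 0)).pair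
      (hf.comp (of_computable ca)))).pair (of_computable (ca.pair (ci.pair Computable.snd)))
  exact (IsSigmaFun.subst hR.reflTransGen h₂).of_eq fun x => (key _ _ _).symm

end

/-! ### Gluing embeddings of finite pieces -/

/-- `L` is a computable tree whose nodes are the numbers `n` with `L n n`. -/
structure IsComputableTreeRel (L : ℕ → ℕ → Prop) : Prop where
  left : ∀ {a b}, L a b → L a a
  right : ∀ {a b}, L a b → L b b
  antisymm : ∀ {a b}, L a b → L b a → a = b
  trans : ∀ {a b c}, L a b → L b c → L a c
  exists_root : ∃ root, L root root ∧ ∀ a, L a a → L root a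
  finite_below : ∀ a, {b | L b a}.Finite
  linear_below : ∀ {a b c}, L b a → L c a → L b c ∨ L c b
  computable : ComputablePred fun x : ℕ × ℕ => L x.1 x.2

/-- The order of a tree on `T ⊆ ℕ`, as a relation on `ℕ`. -/
def natRel (T : Set ℕ) (r : T → T → Prop) (n m : ℕ) : Prop :=
  ∃ (h₁ : n ∈ T) (h₂ : m ∈ T), r ⟨n, h₁⟩ ⟨m, h₂⟩

theorem natRel_self {T : Set ℕ} {r : T → T → Prop} (h : IsTree r) {n : ℕ} :
    natRel T r n n ↔ n ∈ T :=
  ⟨fun ⟨h, _⟩ => h, fun hn => ⟨hn, hn, h.refl _⟩⟩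

theorem IsComputableTree.isComputableTreeRel {T : Set ℕ} {r : T → T → Prop}
    (h : IsComputableTree T r) : IsComputableTreeRel (natRel T r) where
  left := fun ⟨h₁, _, _⟩ => (natRel_self h.isTree).2 h₁
  right := fun ⟨_, h₂, _⟩ => (natRel_self h.isTree).2 h₂
  antisymm := fun ⟨_, _, h₁⟩ ⟨_, _, h₂⟩ => congrArg Subtype.val (h.isTree.antisymm _ _ h₁ h₂)
  trans := fun ⟨h₁, _, h₂⟩ ⟨_, h₃, h₄⟩ => ⟨h₁, h₃, h.isTree.trans _ _ _ h₂ h₄⟩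
  exists_root := by
    obtain ⟨ρ, hρ⟩ := h.isTree.exists_root
    exact ⟨ρ, ⟨ρ.2, ρ.2, hρ _⟩, fun a ⟨ha, _⟩ => ⟨ρ.2, ha, hρ _⟩⟩
  finite_below := fun a => by
    by_cases ha : a ∈ T
    · refine ((h.isTree.finite_below ⟨a, ha⟩).image Subtype.val).subset ?_
      rintro b ⟨hb, _, hba⟩
      exact ⟨⟨b, hb⟩, hba, rfl⟩
    · exact Set.finite_empty.subset fun b ⟨_, h, _⟩ => ha h
  linear_below := fun ⟨h₁, _, h₂⟩ ⟨h₃, _, h₄⟩ =>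
    (h.isTree.linear_below _ _ _ h₂ h₄).imp (fun h => ⟨h₁, h₃, h⟩) fun h => ⟨h₃, h₁, h⟩
  computable := h.computable_rel

/-- `L` has a self-embedding that is not onto and has a `Σ⁰₃` graph. -/
def HasSigmaSelfEmbedding (L : ℕ → ℕ → Prop) : Prop :=
  ∃ f : ℕ → ℕ, (∀ n, L n n → L (f n) (f n)) ∧
    (∀ n m, L n n → L m m → (L n m ↔ L (f n) (f m))) ∧
    (∃ m, L m m ∧ ∀ n, L n n → f n ≠ m) ∧
    IsSigma 3 fun x : ℕ × ℕ => L x.1 x.1 ∧ f x.1 = x.2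

theorem HasSigmaSelfEmbedding.exists_isComputableFrom {T : Set ℕ} {r : T → T → Prop}
    (hr : IsTree r) (h : HasSigmaSelfEmbedding (natRel T r)) :
    ∃ f : r ↪r r, ¬ Function.Surjective f ∧
      IsComputableFrom (turingJump (turingJump ∅)) T f := by
  obtain ⟨f, hmem, hrel, ⟨m, hm, hfm⟩, hsig⟩ := h
  simp only [natRel_self hr] at hmem hrel hm hfm hsig
  let g : T → T := fun x => ⟨f x, hmem x x.2⟩
  have hg : ∀ {x y : T}, r (g x) (g y) ↔ r x y := fun {x y} =>
    ⟨fun h => ((hrel x y x.2 y.2).2 ⟨_, _, h⟩).2.2, fun h => ((hrel x y x.2 y.2).1 ⟨_, _, h⟩).2.2⟩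
  have hinj : Function.Injective g := fun x y hxy =>
    hr.antisymm _ _ (hg.1 (hxy ▸ hr.refl _)) (hg.1 (hxy ▸ hr.refl _))
  refine ⟨⟨⟨g, hinj⟩, hg⟩, fun hsurj => ?_, ?_⟩
  · obtain ⟨x, hx⟩ := hsurj ⟨m, hm⟩
    exact hfm x x.2 (congrArg Subtype.val hx)
  · refine IsSigma.turingReducible (n := 2) (hsig.of_eq fun x => ?_)
    exact ⟨fun ⟨h₁, h₂⟩ => ⟨h₁, h₂⟩, fun ⟨h₁, h₂⟩ => ⟨h₁, h₂⟩⟩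

namespace IsComputableTreeRel

variable {L : ℕ → ℕ → Prop} {α : Type} [Primcodable α] {n : ℕ}

theorem isSigma (hL : IsComputableTreeRel L) {f g : α → ℕ} (hf : Computable f) (hg : Computable g) :
    IsSigma n fun a => L (f a) (g a) :=
  IsSigma.of_computablePred (hL.computable.comp (hf.pair hg))

theorem isSigma_not (hL : IsComputableTreeRel L) {f g : α → ℕ} (hf : Computable f)
    (hg : Computable g) :
    IsSigma n fun a => ¬ L (f a) (g a) :=
  IsSigma.of_computablePred (hL.computable.comp (hf.pair hg)).not

theorem isForestOrder (hL : IsComputableTreeRel L) : IsForestOrder fun a b => L a b ∨ a = b where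
  refl _ := .inr rfl
  antisymm := by
    rintro a b (h | rfl) (h' | h')
    exacts [hL.antisymm h h', h'.symm, rfl, rfl]
  trans := by
    rintro a b c (h | rfl) (h' | rfl)
    exacts [.inl (hL.trans h h'), .inl h, .inl h', .inr rfl]
  linear_below := by
    rintro a b c (h | rfl) (h' | rfl)
    exacts [(hL.linear_below h h').imp .inl .inl, .inl (.inl h), .inr (.inl h'), .inl (.inr rfl)]

end IsComputableTreeRel

/-- `D` is a sequence of disjoint finite pieces of the tree `L`, each with a least element `ρ i`,
arranged either as a chain (every node of a later piece lies above the least element of an earlier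
one, and above no other node of it) or as an antichain; the nodes outside of the pieces do not
distinguish between them. The sequence is computable in `0''`. -/
structure IsPieceSequence (L : ℕ → ℕ → Prop) (D : ℕ → ℕ → Prop) (ρ M : ℕ → ℕ) (chain : Prop) :
    Prop where
  isSigma : IsSigma 3 fun x : ℕ × ℕ => D x.1 x.2
  isSigma_not : IsSigma 3 fun x : ℕ × ℕ => ¬ D x.1 x.2
  isSigmaFun_root : IsSigmaFun 3 ρ
  isSigmaFun_bound : IsSigmaFun 3 M
  isSigma_outside : IsSigma 3 fun n => L n n ∧ ∀ i, ¬ D i n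
  lt_bound : ∀ i a, D i a → a < M i
  root_mem : ∀ i, D i (ρ i)
  root_le : ∀ i a, D i a → L (ρ i) a
  rel_iff : ∀ i j a b, i < j → D i a → D j b → (L a b ↔ chain ∧ a = ρ i)
  not_rel : ∀ i j a b, i < j → D i a → D j b → ¬ L b a
  outside_iff : ∀ n, L n n → (∀ i, ¬ D i n) → ∀ i a, D i a → (L n a ↔ L n (ρ 0))
  not_outside : ∀ n, L n n → (∀ i, ¬ D i n) → ∀ i a, D i a → ¬ L a n

namespace IsPieceSequence

variable {L : ℕ → ℕ → Prop} {D : ℕ → ℕ → Prop} {ρ M : ℕ → ℕ} {chain : Prop}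

theorem mem_tree (hL : IsComputableTreeRel L) (h : IsPieceSequence L D ρ M chain) {i a : ℕ}
    (ha : D i a) : L a a := hL.right (h.root_le i a ha)

theorem index_unique (hL : IsComputableTreeRel L) (h : IsPieceSequence L D ρ M chain) {i j a : ℕ}
    (hi : D i a) (hj : D j a) : i = j := by
  rcases lt_trichotomy i j with hij | hij | hij
  · exact absurd (h.mem_tree hL hi) (h.not_rel i j a a hij hi hj)
  · exact hij
  · exact absurd (h.mem_tree hL hi) (h.not_rel j i a a hij hj hi)

theorem shift (hL : IsComputableTreeRel L) (h : IsPieceSequence L D ρ M chain) (k : ℕ) :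
    IsPieceSequence L (fun i => D (i + k)) (fun i => ρ (i + k)) (fun i => M (i + k)) chain := by
  have hk : Computable fun i => i + k :=
    (Primrec.nat_add.comp Primrec.id (Primrec.const k)).to_comp
  have hk' : Computable fun x : ℕ × ℕ => (x.1 + k, x.2) :=
    (hk.comp Computable.fst).pair Computable.snd
  have hout : ∀ n, (∀ i, ¬ D (i + k) n) → (∀ i, ¬ D i n) ∨ ∃ i < k, D i n := by
    intro n hn
    by_cases hn' : ∃ i, D i n
    · obtain ⟨i, hi⟩ := hn'
      refine .inr ⟨i, ?_, hi⟩
      by_contra hik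
      exact hn (i - k) (by rwa [Nat.sub_add_cancel (by omega)])
    · exact .inl fun i hi => hn' ⟨i, hi⟩
  refine ⟨h.isSigma.comp hk', h.isSigma_not.comp hk', h.isSigmaFun_root.comp (.of_computable hk),
    h.isSigmaFun_bound.comp (.of_computable hk), ?_, fun i => h.lt_bound _, fun i => h.root_mem _,
    fun i => h.root_le _, fun i j a b hij => h.rel_iff _ _ a b (by omega),
    fun i j a b hij => h.not_rel _ _ a b (by omega), ?_, ?_⟩
  · have h₁ : IsSigma 3 fun n => ∃ i, i < k ∧ D i n := by
      have c : Computable fun x : ℕ × ℕ => (x.2, x.1) := Computable.snd.pair Computable.fst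
      have h₂ : IsSigma 3 fun x : ℕ × ℕ => x.2 < k :=
        .of_computablePred (.lt' Computable.snd (Computable.const k))
      exact IsSigma.exists_nat (p := fun n i => i < k ∧ D i n) (h₂.and (h.isSigma.comp c))
    refine (h.isSigma_outside.or h₁).of_eq fun n => ?_
    constructor
    · rintro (⟨hn, hn'⟩ | ⟨i, hi, hn⟩)
      · exact ⟨hn, fun i => hn' _⟩
      · refine ⟨h.mem_tree hL hn, fun j hj => ?_⟩
        have := h.index_unique hL hn hj
        omega
    · rintro ⟨hn, hn'⟩
      exact (hout n hn').imp (fun h => ⟨hn, h⟩) id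
  · intro n hn hn' i a ha
    rcases hout n hn' with ho | ⟨j, hj, hjn⟩
    · rw [h.outside_iff n hn ho _ a ha, h.outside_iff n hn ho _ _ (h.root_mem (0 + k))]
    · rw [h.rel_iff j _ n a (by omega) hjn ha,
        h.rel_iff j _ n _ (by omega) hjn (h.root_mem (0 + k))]
  · intro n hn hn' i a ha
    rcases hout n hn' with ho | ⟨j, hj, hjn⟩
    · exact h.not_outside n hn ho _ a ha
    · exact h.not_rel j _ n a (by omega) hjn ha

/-- `c` codes an embedding of the `i`-th piece into the `j`-th one that maps the least element,
and only that, to the least element. -/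
def CodesEmbedding (L D : ℕ → ℕ → Prop) (ρ : ℕ → ℕ) (i j c : ℕ) : Prop :=
  ∀ a, D i a → D j (listEntry c a) ∧ (listEntry c a = ρ j ↔ a = ρ i) ∧
    ∀ b, D i b → (L a b ↔ L (listEntry c a) (listEntry c b))

theorem isSigma_codesEmbedding (hL : IsComputableTreeRel L) (h : IsPieceSequence L D ρ M chain) :
    IsSigma 3 fun x : ℕ × ℕ × ℕ => CodesEmbedding L D ρ x.1 x.2.1 x.2.2 := by
  -- the parameters are `((i, j, c), (M i, ρ i, ρ j))`
  let P := (ℕ × ℕ × ℕ) × ℕ × ℕ × ℕ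
  have ci : Computable fun x : P => x.1.1 := Computable.fst.comp Computable.fst
  have cj : Computable fun x : P => x.1.2.1 :=
    Computable.fst.comp (Computable.snd.comp Computable.fst)
  have cc : Computable fun x : P => x.1.2.2 :=
    Computable.snd.comp (Computable.snd.comp Computable.fst)
  have cM : Computable fun x : P => x.2.1 := Computable.fst.comp Computable.snd
  have cu : Computable fun x : P => x.2.2.1 :=
    Computable.fst.comp (Computable.snd.comp Computable.snd)
  have cv : Computable fun x : P => x.2.2.2 :=
    Computable.snd.comp (Computable.snd.comp Computable.snd)
  have ce₁ : Computable fun x : P × ℕ => listEntry x.1.1.2.2 x.2 :=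
    computable_listEntry.comp (cc.comp Computable.fst) Computable.snd
  have h₁ : IsSigma 3 fun x : (P × ℕ) × ℕ => ¬ D x.1.1.1.1 x.2 ∨
      (L x.1.2 x.2 ↔ L (listEntry x.1.1.1.2.2 x.1.2) (listEntry x.1.1.1.2.2 x.2)) := by
    have c₁ : Computable fun x : (P × ℕ) × ℕ => x.1.2 := Computable.snd.comp Computable.fst
    have c₂ : Computable fun x : (P × ℕ) × ℕ => listEntry x.1.1.1.2.2 x.1.2 :=
      ce₁.comp Computable.fst
    have c₃ : Computable fun x : (P × ℕ) × ℕ => listEntry x.1.1.1.2.2 x.2 :=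
      computable_listEntry.comp (cc.comp (Computable.fst.comp Computable.fst)) Computable.snd
    have c₄ : Computable fun x : (P × ℕ) × ℕ => (x.1.1.1.1, x.2) :=
      (ci.comp (Computable.fst.comp Computable.fst)).pair Computable.snd
    refine (h.isSigma_not.comp c₄).or (IsSigma.of_eq
      (((hL.isSigma c₁ Computable.snd).and (hL.isSigma c₂ c₃)).or
        ((hL.isSigma_not c₁ Computable.snd).and (hL.isSigma_not c₂ c₃))) fun x => by tauto)
  have h₂ : IsSigma 3 fun x : P × ℕ => ∀ b < x.1.2.1, ¬ D x.1.1.1 b ∨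
      (L x.2 b ↔ L (listEntry x.1.1.2.2 x.2) (listEntry x.1.1.2.2 b)) :=
    IsSigma.forall_lt (p := fun (x : P × ℕ) b => ¬ D x.1.1.1 b ∨
      (L x.2 b ↔ L (listEntry x.1.1.2.2 x.2) (listEntry x.1.1.2.2 b))) h₁ (cM.comp Computable.fst)
  have h₃ : IsSigma 3 fun x : P × ℕ => (listEntry x.1.1.2.2 x.2 = x.1.2.2.2 ↔ x.2 = x.1.2.2.1) := by
    have e₁ := ComputablePred.eq' ce₁ (cv.comp Computable.fst)
    have e₂ := ComputablePred.eq' Computable.snd (cu.comp Computable.fst)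
    exact (IsSigma.of_computablePred ((e₁.and e₂).or (e₁.not.and e₂.not))).of_eq
      fun x => by tauto
  have c₅ : Computable fun x : P × ℕ => (x.1.1.1, x.2) :=
    (ci.comp Computable.fst).pair Computable.snd
  have c₆ : Computable fun x : P × ℕ => (x.1.1.2.1, listEntry x.1.1.2.2 x.2) :=
    (cj.comp Computable.fst).pair ce₁
  have h₄ := IsSigma.forall_lt (p := fun (x : P) a => ¬ D x.1.1 a ∨
    (D x.1.2.1 (listEntry x.1.2.2 a) ∧ (listEntry x.1.2.2 a = x.2.2.2 ↔ a = x.2.2.1) ∧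
    ∀ b < x.2.1, ¬ D x.1.1 b ∨ (L a b ↔ L (listEntry x.1.2.2 a) (listEntry x.1.2.2 b))))
    ((h.isSigma_not.comp c₅).or ((h.isSigma.comp c₆).and (h₃.and h₂))) cM
  have c₇ : Computable fun x : ℕ × ℕ × ℕ => x.2.1 := Computable.fst.comp Computable.snd
  have h₅ : IsSigmaFun 3 fun x : ℕ × ℕ × ℕ => ((x, M x.1, ρ x.1, ρ x.2.1) : P) :=
    (IsSigmaFun.of_computable Computable.id).pair
      ((h.isSigmaFun_bound.comp (.of_computable Computable.fst)).pair
        ((h.isSigmaFun_root.comp (.of_computable Computable.fst)).pair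
          (h.isSigmaFun_root.comp (.of_computable c₇))))
  refine (IsSigmaFun.subst h₄ h₅).of_eq fun x => ?_
  constructor
  · intro H a ha
    obtain ⟨h₁, h₂, h₃⟩ := (H a (h.lt_bound _ _ ha)).resolve_left (not_not.2 ha)
    exact ⟨h₁, h₂, fun b hb => (h₃ b (h.lt_bound _ _ hb)).resolve_left (not_not.2 hb)⟩
  · intro H a _
    refine or_iff_not_imp_left.2 fun ha => ?_
    obtain ⟨h₁, h₂, h₃⟩ := H a (not_not.1 ha)
    exact ⟨h₁, h₂, fun b _ => or_iff_not_imp_left.2 fun hb => h₃ b (not_not.1 hb)⟩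

/-- By Kruskal's theorem, every piece from some index on embeds into infinitely many later ones. -/
theorem exists_codesEmbedding (hL : IsComputableTreeRel L) (h : IsPieceSequence L D ρ M chain) :
    ∃ k, ∀ i ≥ k, ∀ m, ∃ j > m, ∃ c, CodesEmbedding L D ρ i j c := by
  classical
  let F : ℕ → Finset ℕ := fun i => (Finset.range (M i)).filter fun a => D i a
  have hF : ∀ i a, a ∈ F i ↔ D i a := fun i a => by
    simpa [F] using h.lt_bound i a
  have hroot : ∀ i, IsRootedAt (fun a b => L a b ∨ a = b) (F i) (ρ i) := fun i =>
    ⟨(hF _ _).2 (h.root_mem i), fun a ha => .inl (h.root_le i a ((hF _ _).1 ha))⟩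
  obtain ⟨k, hk⟩ := exists_forall_finsetEmbeds hL.isForestOrder hroot
  refine ⟨k, fun i hi m => ?_⟩
  obtain ⟨j, hj, hij⟩ := hk i hi m
  obtain ⟨e, he, heρ, hrel⟩ :=
    hij.exists_root_preserving hL.isForestOrder (hroot i) (hroot j)
  obtain ⟨c, hc⟩ := exists_listEntry_eq e (M i)
  have hc' : ∀ a, D i a → listEntry c a = e a := fun a ha => hc a (h.lt_bound _ _ ha)
  have hor : ∀ {a b}, L a a → ((L a b ∨ a = b) ↔ L a b) := fun ha =>
    ⟨fun h => h.elim id fun h => h ▸ ha, .inl⟩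
  refine ⟨j, hj, c, fun a ha => ?_⟩
  have hea := (hF _ _).1 (he a ((hF _ _).2 ha))
  rw [hc' a ha]
  refine ⟨hea, heρ a ((hF _ _).2 ha), fun b hb => ?_⟩
  rw [hc' b hb]
  have := hrel a ((hF _ _).2 ha) b ((hF _ _).2 hb)
  rwa [hor (h.mem_tree hL ha), hor (h.mem_tree hL hea)] at this

/-- Given embeddings of each piece into infinitely many others, `0''` can choose embeddings into
pieces with increasing indices. Together with the identity outside of the pieces, they form a
self-embedding of the tree that misses the first piece. -/
theorem hasSigmaSelfEmbedding_of_forall (hL : IsComputableTreeRel L)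
    (h : IsPieceSequence L D ρ M chain)
    (hemb : ∀ i m, ∃ j > m, ∃ c, CodesEmbedding L D ρ i j c) : HasSigmaSelfEmbedding L := by
  classical
  obtain ⟨H, hH, hH'⟩ := IsSigma.exists_isSigmaFun (n := 2)
    (p := fun (x y : ℕ × ℕ) => x.2 < y.1 ∧ CodesEmbedding L D ρ x.1 y.1 y.2) (by
      have c₁ : Computable fun x : (ℕ × ℕ) × ℕ × ℕ => x.1.2 := Computable.snd.comp Computable.fst
      have c₂ : Computable fun x : (ℕ × ℕ) × ℕ × ℕ => x.2.1 := Computable.fst.comp Computable.snd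
      have c₃ : Computable fun x : (ℕ × ℕ) × ℕ × ℕ => (x.1.1, x.2) :=
        (Computable.fst.comp Computable.fst).pair Computable.snd
      exact (IsSigma.of_computablePred (.lt' c₁ c₂)).and ((h.isSigma_codesEmbedding hL).comp c₃))
    (fun x => by
      obtain ⟨j, hj, c, hc⟩ := hemb x.1 x.2
      exact ⟨(j, c), hj, hc⟩)
  let s : ℕ → ℕ × ℕ := fun i => i.rec (H (0, 0)) fun i x => H (i + 1, x.1)
  have hs : IsSigmaFun 3 s := by
    have h₁ : IsSigmaFun 3 fun _ : ℕ => H (0, 0) := hH.comp (.of_computable (.const (0, 0)))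
    have c₂ : Computable fun x : ℕ × ℕ × (ℕ × ℕ) => (x.2.1 + 1, x.2.2.1) :=
      (Computable.succ.comp (Computable.fst.comp Computable.snd)).pair
        (Computable.fst.comp (Computable.snd.comp Computable.snd))
    have h₂ : IsSigmaFun 3 fun x : ℕ × ℕ × (ℕ × ℕ) => H (x.2.1 + 1, x.2.2.1) :=
      hH.comp (.of_computable c₂)
    have h₃ : IsSigmaFun 3 fun x : ℕ × ℕ => s x.2 :=
      IsSigmaFun.nat_rec (F := fun _ i => s i) h₁ h₂ (fun _ => rfl) fun _ _ => rfl
    exact h₃.comp (.of_computable (Computable.id.pair Computable.id))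
  have hemb' : ∀ i, CodesEmbedding L D ρ i (s i).1 (s i).2 := by
    rintro (_ | i)
    · exact (hH' (0, 0)).2
    · exact (hH' (i + 1, (s i).1)).2
  have hmono : StrictMono fun i => (s i).1 :=
    strictMono_nat_of_lt_succ fun i => (hH' (i + 1, (s i).1)).1
  have hpos : ∀ i, 0 < (s i).1 := fun i =>
    (show 0 < (s 0).1 from (hH' (0, 0)).1).trans_le (hmono.monotone (Nat.zero_le i))
  let f : ℕ → ℕ := fun n => if hn : ∃ i, D i n then listEntry (s hn.choose).2 n else n
  have hf : ∀ {i n}, D i n → f n = listEntry (s i).2 n := fun {i n} hn => by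
    have hn' : ∃ i, D i n := ⟨i, hn⟩
    simp only [f, dif_pos hn']
    rw [h.index_unique hL hn'.choose_spec hn]
  have hf' : ∀ {n}, (∀ i, ¬ D i n) → f n = n := fun {n} hn =>
    dif_neg fun ⟨i, hi⟩ => hn i hi
  have hfD : ∀ {i n}, D i n → D (s i).1 (f n) := fun {i n} hn => hf hn ▸ (hemb' i n hn).1
  have hfρ : ∀ {i n}, D i n → (f n = ρ (s i).1 ↔ n = ρ i) := fun {i n} hn =>
    hf hn ▸ (hemb' i n hn).2.1
  have hcase : ∀ n, (∀ i, ¬ D i n) ∨ ∃ i, D i n := fun n => by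
    by_cases hn : ∃ i, D i n
    · exact .inr hn
    · exact .inl fun i hi => hn ⟨i, hi⟩
  refine ⟨f, fun n hn => ?_, fun n m hn hm => ?_, ⟨ρ 0, h.mem_tree hL (h.root_mem 0), ?_⟩, ?_⟩
  · rcases hcase n with ho | ⟨i, hi⟩
    · rwa [hf' ho]
    · exact h.mem_tree hL (hfD hi)
  · rcases hcase n with ho | ⟨i, hi⟩ <;> rcases hcase m with ho' | ⟨j, hj⟩
    · rw [hf' ho, hf' ho']
    · rw [hf' ho, h.outside_iff n hn ho j m hj, h.outside_iff n hn ho _ _ (hfD hj)]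
    · rw [hf' ho']
      exact iff_of_false (h.not_outside m hm ho' i n hi) (h.not_outside m hm ho' _ _ (hfD hi))
    · rcases lt_trichotomy i j with hij | rfl | hij
      · rw [h.rel_iff i j n m hij hi hj, h.rel_iff _ _ _ _ (hmono hij) (hfD hi) (hfD hj), hfρ hi]
      · rw [hf hi, hf hj]
        exact (hemb' i n hi).2.2 m hj
      · exact iff_of_false (h.not_rel j i m n hij hj hi)
          (h.not_rel _ _ _ _ (hmono hij) (hfD hj) (hfD hi))
  · intro n hn hn'
    rcases hcase n with ho | ⟨i, hi⟩
    · rw [hf' ho] at hn'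
      exact ho 0 (hn' ▸ h.root_mem 0)
    · exact (hpos i).ne' (h.index_unique hL (hfD hi) (hn' ▸ h.root_mem 0))
  · have h₁ : IsSigma 3 fun x : ℕ × ℕ => x.1 = x.2 :=
      .of_computablePred (.eq' Computable.fst Computable.snd)
    have h₂ : IsSigma 3 fun x : ℕ × ℕ => ∃ i, D i x.1 ∧ listEntry (s i).2 x.1 = x.2 := by
      have c₁ : Computable fun x : (ℕ × ℕ) × ℕ => (x.2, x.1.1) :=
        Computable.snd.pair (Computable.fst.comp Computable.fst)
      have c₂ : Computable fun x : (ℕ × ℕ) × (ℕ × ℕ) => listEntry x.1.2 x.2.1 :=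
        computable_listEntry.comp (Computable.snd.comp Computable.fst)
          (Computable.fst.comp Computable.snd)
      have h₃ : IsSigma 3 fun x : (ℕ × ℕ) × (ℕ × ℕ) => listEntry x.1.2 x.2.1 = x.2.2 :=
        .of_computablePred (.eq' c₂ (Computable.snd.comp Computable.snd))
      have h₄ : IsSigmaFun 3 fun x : (ℕ × ℕ) × ℕ => (s x.2, x.1) :=
        (hs.comp (.of_computable Computable.snd)).pair (.of_computable Computable.fst)
      exact IsSigma.exists_nat (p := fun (x : ℕ × ℕ) i => D i x.1 ∧ listEntry (s i).2 x.1 = x.2)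
        ((h.isSigma.comp c₁).and (IsSigmaFun.subst h₃ h₄))
    refine (((h.isSigma_outside.comp Computable.fst).and h₁).or h₂).of_eq fun x => ?_
    constructor
    · rintro (⟨⟨hx, ho⟩, he⟩ | ⟨i, hi, he⟩)
      · exact ⟨hx, (hf' ho).trans he⟩
      · exact ⟨h.mem_tree hL hi, (hf hi).trans he⟩
    · rintro ⟨hx, he⟩
      rcases hcase x.1 with ho | ⟨i, hi⟩
      · exact .inl ⟨⟨hx, ho⟩, (hf' ho).symm.trans he⟩
      · exact .inr ⟨i, hi, (hf hi).symm.trans he⟩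

theorem hasSigmaSelfEmbedding (hL : IsComputableTreeRel L) (h : IsPieceSequence L D ρ M chain) :
    HasSigmaSelfEmbedding L := by
  obtain ⟨k, hk⟩ := h.exists_codesEmbedding hL
  refine (h.shift hL k).hasSigmaSelfEmbedding_of_forall hL fun i m => ?_
  obtain ⟨j, hj, c, hc⟩ := hk (i + k) (by omega) (m + k)
  refine ⟨j - k, by omega, c, fun a ha => ?_⟩
  have hjk : j - k + k = j := Nat.sub_add_cancel (by omega)
  simp only [hjk]
  exact hc a ha

end IsPieceSequence

/-! ### The three kinds of trees -/

/-- `y` is an immediate successor of `x` in the tree `L`. -/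
def IsChild (L : ℕ → ℕ → Prop) (x y : ℕ) : Prop :=
  L x y ∧ x ≠ y ∧ ∀ z, L x z → L z y → z = x ∨ z = y

/-- There are infinitely many nodes above `x`. -/
def InfiniteAbove (L : ℕ → ℕ → Prop) (x : ℕ) : Prop :=
  {y | L x y}.Infinite

namespace IsComputableTreeRel

variable {L : ℕ → ℕ → Prop} {x y z n c c' : ℕ}

theorem isSigma_isChild (hL : IsComputableTreeRel L) :
    IsSigma 3 fun x : ℕ × ℕ => IsChild L x.1 x.2 := by
  have c₁ : Computable fun x : (ℕ × ℕ) × ℕ => x.1.1 := Computable.fst.comp Computable.fst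
  have c₂ : Computable fun x : (ℕ × ℕ) × ℕ => x.1.2 := Computable.snd.comp Computable.fst
  have h₁ : IsSigma 0 fun x : (ℕ × ℕ) × ℕ =>
      ¬ L x.1.1 x.2 ∨ ¬ L x.2 x.1.2 ∨ x.2 = x.1.1 ∨ x.2 = x.1.2 :=
    (hL.isSigma_not c₁ Computable.snd).or ((hL.isSigma_not Computable.snd c₂).or
      ((IsSigma.of_computablePred (.eq' Computable.snd c₁)).or
        (IsSigma.of_computablePred (.eq' Computable.snd c₂))))
  have h₂ := (IsSigma.all (p := fun (x : ℕ × ℕ) z =>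
    ¬ L x.1 z ∨ ¬ L z x.2 ∨ z = x.1 ∨ z = x.2) h₁).succ
  have h₃ : IsSigma 3 fun x : ℕ × ℕ => ¬ x.1 = x.2 :=
    .of_computablePred (ComputablePred.eq' Computable.fst Computable.snd).not
  refine ((hL.isSigma Computable.fst Computable.snd).and (h₃.and h₂)).of_eq fun x => ?_
  refine and_congr_right fun _ => and_congr_right fun _ => forall_congr' fun z => ?_
  tauto

theorem isSigma_exists_gt (hL : IsComputableTreeRel L) :
    IsSigma 1 fun x : ℕ × ℕ => ∃ y, L x.1 y ∧ x.2 < y := by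
  have h₁ : IsSigma 1 fun x : (ℕ × ℕ) × ℕ => x.1.2 < x.2 :=
    .of_computablePred (.lt' (Computable.snd.comp Computable.fst) Computable.snd)
  exact IsSigma.exists_nat (p := fun (x : ℕ × ℕ) y => L x.1 y ∧ x.2 < y)
    ((hL.isSigma (Computable.fst.comp Computable.fst) Computable.snd).and h₁)

theorem infiniteAbove_iff : InfiniteAbove L x ↔ ∀ b, ∃ y, L x y ∧ b < y :=
  Set.infinite_iff_exists_gt

theorem isSigma_infiniteAbove (hL : IsComputableTreeRel L) : IsSigma 3 (InfiniteAbove L) :=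
  (IsSigma.all (p := fun x b => ∃ y, L x y ∧ b < y) hL.isSigma_exists_gt).of_eq
    fun _ => infiniteAbove_iff.symm

theorem isSigma_not_infiniteAbove (hL : IsComputableTreeRel L) :
    IsSigma 3 fun x => ¬ InfiniteAbove L x :=
  (IsSigma.exists_nat (p := fun x b => ¬ ∃ y, L x y ∧ b < y) hL.isSigma_exists_gt.not).succ.of_eq
    fun _ => by rw [infiniteAbove_iff, not_forall]

theorem ncard_below_lt (hL : IsComputableTreeRel L) (h : L x y) (hne : x ≠ y) :
    {b | L b x}.ncard < {b | L b y}.ncard :=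
  Set.ncard_lt_ncard ⟨fun _ hb => hL.trans hb h, fun hsub =>
    hne (hL.antisymm h (hsub (show L y y from hL.right h)))⟩ (hL.finite_below y)

theorem exists_isChild_le (hL : IsComputableTreeRel L) (h : L x y) (hne : x ≠ y) :
    ∃ c, IsChild L x c ∧ L c y := by
  obtain ⟨c, ⟨h₁, h₂, h₃⟩, hmin⟩ := Set.exists_min_image {b | L b y ∧ L x b ∧ x ≠ b}
    (fun b => {a | L a b}.ncard) ((hL.finite_below y).subset fun _ h => h.1)
    ⟨y, hL.right h, h, hne⟩
  refine ⟨c, ⟨h₂, h₃, fun z hxz hzc => ?_⟩, h₁⟩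
  by_contra! hcon
  exact absurd (hL.ncard_below_lt hzc hcon.2)
    (not_lt.2 (hmin z ⟨hL.trans hzc h₁, hxz, hcon.1.symm⟩))

theorem exists_parent (hL : IsComputableTreeRel L) (h : L x y) (hne : x ≠ y) :
    ∃ p, IsChild L p y := by
  obtain ⟨p, ⟨h₁, h₂⟩, hmax⟩ := Set.exists_max_image {b | L b y ∧ b ≠ y}
    (fun b => {a | L a b}.ncard) ((hL.finite_below y).subset fun _ h => h.1) ⟨x, h, hne⟩
  refine ⟨p, h₁, h₂, fun z hpz hzy => ?_⟩
  by_contra! hcon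
  exact absurd (hL.ncard_below_lt hpz hcon.1.symm) (not_lt.2 (hmax z ⟨hzy, hcon.2⟩))

theorem parent_unique (hL : IsComputableTreeRel L) (h : IsChild L x c) (h' : IsChild L y c) :
    x = y := by
  rcases hL.linear_below h.1 h'.1 with hl | hl
  · exact ((h.2.2 y hl h'.1).resolve_right h'.2.1).symm
  · exact (h'.2.2 x hl h.1).resolve_right h.2.1

theorem isChild_eq_of_le (h : IsChild L x c) (h' : IsChild L x c') (hle : L c c') : c = c' :=
  (h'.2.2 c h.1 hle).resolve_left h.2.1.symm

theorem isChild_eq_of_le_of_le (hL : IsComputableTreeRel L) (h : IsChild L x c)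
    (h' : IsChild L x c') (hn : L c n) (hn' : L c' n) : c = c' :=
  (hL.linear_below hn hn').elim (isChild_eq_of_le h h') fun hl => (isChild_eq_of_le h' h hl).symm

theorem tree_induction (hL : IsComputableTreeRel L) {root : ℕ} (hroot : ∀ a, L a a → L root a)
    {P : ℕ → Prop} (h0 : P root) (hs : ∀ p c, IsChild L p c → P p → P c) {n : ℕ} (hn : L n n) :
    P n := by
  induction hk : {b | L b n}.ncard using Nat.strong_induction_on generalizing n with
  | _ k ih =>
    by_cases hne : root = n
    · exact hne ▸ h0
    · obtain ⟨p, hp⟩ := hL.exists_parent (hroot n hn) hne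
      exact hs p n hp (ih _ (hk ▸ hL.ncard_below_lt hp.1 hp.2.1) (hL.left hp.1) rfl)

/-- A node with infinitely many children that have only finitely many nodes above them: the sets
of nodes above these children form an antichain of finite pieces. -/
theorem hasSigmaSelfEmbedding_of_infinite_children (hL : IsComputableTreeRel L)
    (hx : {c | IsChild L x c ∧ ¬ InfiniteAbove L c}.Infinite) : HasSigmaSelfEmbedding L := by
  have hc : IsSigma 3 fun c => IsChild L x c :=
    hL.isSigma_isChild.comp ((Computable.const x).pair Computable.id)
  obtain ⟨f, hf, hf'⟩ := IsSigma.exists_isSigmaFun (n := 2)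
    (p := fun m c => m < c ∧ IsChild L x c ∧ ¬ InfiniteAbove L c)
    ((IsSigma.of_computablePred (.lt' Computable.fst Computable.snd)).and
      ((hc.and hL.isSigma_not_infiniteAbove).comp Computable.snd))
    (fun m => by
      obtain ⟨c, hc, hmc⟩ := Set.infinite_iff_exists_gt.1 hx m
      exact ⟨c, hmc, hc⟩)
  let C : ℕ → ℕ := fun i => i.rec (f 0) fun _ c => f c
  have hC : IsSigmaFun 3 C := by
    have h₂ : IsSigmaFun 3 fun x : ℕ × ℕ × ℕ => f x.2.2 :=
      hf.comp (.of_computable (Computable.snd.comp Computable.snd))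
    have h₃ : IsSigmaFun 3 fun x : ℕ × ℕ => C x.2 :=
      IsSigmaFun.nat_rec (F := fun _ i => C i) (.of_computable (.const (f 0))) h₂
        (fun _ => rfl) fun _ _ => rfl
    exact h₃.comp (.of_computable (Computable.id.pair Computable.id))
  have hmono : StrictMono C := strictMono_nat_of_lt_succ fun i => (hf' (C i)).1
  have hchild : ∀ i, IsChild L x (C i)
    | 0 => (hf' 0).2.1
    | i + 1 => (hf' (C i)).2.1
  have hfin : ∀ i, ¬ InfiniteAbove L (C i)
    | 0 => (hf' 0).2.2
    | i + 1 => (hf' (C i)).2.2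
  have hunique : ∀ {i j a}, L (C i) a → L (C j) a → i = j := fun {i j a} hi hj =>
    hmono.injective (hL.isChild_eq_of_le_of_le (hchild i) (hchild j) hi hj)
  obtain ⟨M, hM, hM'⟩ := IsSigma.exists_isSigmaFun (n := 2)
    (p := fun i m => ∀ a, ¬ L (C i) a ∨ a < m) (by
      have h₁ : IsSigma 0 fun x : (ℕ × ℕ) × ℕ => ¬ L x.1.1 x.2 ∨ x.2 < x.1.2 :=
        (hL.isSigma_not (Computable.fst.comp Computable.fst) Computable.snd).or
          (.of_computablePred (.lt' Computable.snd (Computable.snd.comp Computable.fst)))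
      have h₂ : IsSigmaFun 3 fun x : ℕ × ℕ => (C x.1, x.2) :=
        (hC.comp (.of_computable Computable.fst)).pair (.of_computable Computable.snd)
      exact IsSigmaFun.subst (IsSigma.all (p := fun (x : ℕ × ℕ) a => ¬ L x.1 a ∨ a < x.2) h₁).succ
        h₂)
    (fun i => by
      obtain ⟨b, hb⟩ := (Set.not_infinite.1 (hfin i)).bddAbove
      exact ⟨b + 1, fun a => or_iff_not_imp_left.2 fun ha =>
        Nat.lt_succ_of_le (hb (not_not.1 ha))⟩)
  have hCD : IsSigmaFun 3 fun x : ℕ × ℕ => (C x.1, x.2) :=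
    (hC.comp (.of_computable Computable.fst)).pair (.of_computable Computable.snd)
  have houtside : ∀ {n i a}, (∀ i, ¬ L (C i) n) → L (C i) a → (L n a ↔ L n x) := by
    refine fun {n i a} ho ha => ⟨fun h => ?_, fun h => hL.trans h (hL.trans (hchild i).1 ha)⟩
    have hn := (hL.linear_below h ha).resolve_right (ho i)
    rcases hL.linear_below hn (hchild i).1 with hl | hl
    · exact hl
    · rcases (hchild i).2.2 n hl hn with rfl | rfl
      · exact hl
      · exact absurd hn (ho i)
  have hseq : IsPieceSequence L (fun i a => L (C i) a) C M False := by
    refine ⟨IsSigmaFun.subst (p := fun x : ℕ × ℕ => L x.1 x.2)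
        (hL.isSigma Computable.fst Computable.snd) hCD,
      IsSigmaFun.subst (p := fun x : ℕ × ℕ => ¬ L x.1 x.2)
        (hL.isSigma_not Computable.fst Computable.snd) hCD, hC, hM, ?_,
      fun i a ha => (hM' i a).resolve_left (not_not.2 ha), fun i => hL.right (hchild i).1,
      fun i a ha => ha, fun i j a b hij ha hb => ?_, fun i j a b hij ha hb hba => ?_,
      fun n _ ho i a ha => ?_, fun n _ ho i a ha han => ho i (hL.trans ha han)⟩
    · -- a node strictly above `x` is outside if and only if the child of `x` below it is no `C i`
      have h₁ : IsSigma 3 fun x : (ℕ × ℕ) × ℕ => C x.2 ≠ x.1.2 := by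
        have h₂ : IsSigma 3 fun x : ℕ × ℕ => x.1 ≠ x.2 :=
          .of_computablePred (ComputablePred.eq' Computable.fst Computable.snd).not
        exact IsSigmaFun.subst (p := fun x : ℕ × ℕ => x.1 ≠ x.2) h₂
          ((hC.comp (.of_computable Computable.snd)).pair
          (.of_computable (Computable.snd.comp Computable.fst)))
      have h₃ : IsSigma 3 fun x : ℕ × ℕ => ∀ i < x.2 + 1, C i ≠ x.2 :=
        IsSigma.forall_lt (p := fun (x : ℕ × ℕ) i => C i ≠ x.2) h₁
          (Computable.succ.comp Computable.snd)
      have h₄ : IsSigma 3 fun n => ∃ y, IsChild L x y ∧ L y n ∧ ∀ i < y + 1, C i ≠ y :=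
        IsSigma.exists_nat (p := fun n y => IsChild L x y ∧ L y n ∧ ∀ i < y + 1, C i ≠ y)
          ((hc.comp Computable.snd).and ((hL.isSigma Computable.snd Computable.fst).and h₃))
      have h₅ : IsSigma 3 fun n => x = n :=
        .of_computablePred (.eq' (.const x) Computable.id)
      refine ((hL.isSigma Computable.id Computable.id).and
        (((hL.isSigma_not (.const x) Computable.id).or h₅).or h₄)).of_eq fun n =>
          and_congr_right fun hn => ⟨?_, fun ho => ?_⟩
      · rintro ((h | rfl) | ⟨y, hy, hyn, hCy⟩) i hi
        · exact h (hL.trans (hchild i).1 hi)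
        · exact (hchild i).2.1 (hL.antisymm (hchild i).1 hi)
        · obtain rfl := hL.isChild_eq_of_le_of_le (hchild i) hy hi hyn
          exact hCy i (Nat.lt_succ_of_le hmono.le_apply) rfl
      · by_cases hxn : L x n ∧ x ≠ n
        · obtain ⟨y, hy, hyn⟩ := hL.exists_isChild_le hxn.1 hxn.2
          exact .inr ⟨y, hy, hyn, fun i _ hi => ho i (hi ▸ hyn)⟩
        · refine .inl (or_iff_not_imp_left.2 fun h => ?_)
          by_contra hne
          exact hxn ⟨not_not.1 h, hne⟩
    · exact iff_of_false (fun hab => hij.ne (hunique (hL.trans ha hab) hb)) fun h => h.1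
    · exact hij.ne (hunique ha (hL.trans hb hba))
    · rw [houtside ho ha, houtside ho (hL.right (hchild 0).1)]
  exact hseq.hasSigmaSelfEmbedding hL

theorem finite_above_diff (hL : IsComputableTreeRel L)
    (hy : {c | IsChild L y c ∧ ¬ InfiniteAbove L c}.Finite) :
    {a | L y a ∧ ∀ c, IsChild L y c → InfiniteAbove L c → ¬ L c a}.Finite := by
  refine ((hy.biUnion (t := fun c => {a | L c a}) fun c hc => Set.not_infinite.1 hc.2).union
    (Set.finite_singleton y)).subset ?_
  rintro a ⟨ha, ha'⟩
  by_cases hne : y = a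
  · exact .inr hne.symm
  · obtain ⟨c, hc, hca⟩ := hL.exists_isChild_le ha hne
    exact .inl (Set.mem_biUnion (show c ∈ {c | _ ∧ _} from ⟨hc, fun h => ha' c hc h hca⟩) hca)

/-- If the nodes above `x` with infinitely many nodes above them form a chain, then this chain
cuts the tree above `x` into a chain of pieces, which are finite unless some node has infinitely
many children with only finitely many nodes above them. -/
theorem hasSigmaSelfEmbedding_of_chain (hL : IsComputableTreeRel L)
    (hfin : ∀ y, {c | IsChild L y c ∧ ¬ InfiniteAbove L c}.Finite) (hx : InfiniteAbove L x)
    (hchain : ∀ y z, InfiniteAbove L y → InfiniteAbove L z → L x y → L x z → L y z ∨ L z y) :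
    HasSigmaSelfEmbedding L := by
  have hxx : L x x := by
    obtain ⟨y, hy⟩ := hx.nonempty
    exact hL.left hy
  obtain ⟨f, hf, hf'⟩ := IsSigma.exists_isSigmaFun (n := 2)
    (p := fun y c => (¬ InfiniteAbove L y ∨ ¬ L x y) ∨ IsChild L y c ∧ InfiniteAbove L c)
    (((hL.isSigma_not_infiniteAbove.comp Computable.fst).or
      (hL.isSigma_not (.const x) Computable.fst)).or
      (hL.isSigma_isChild.and (hL.isSigma_infiniteAbove.comp Computable.snd)))
    (fun y => by
      by_cases hy : ¬ InfiniteAbove L y ∨ ¬ L x y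
      · exact ⟨0, .inl hy⟩
      · push Not at hy
        by_contra! hcon
        refine hy.1 ((hL.finite_above_diff (hfin y)).subset fun a ha => ⟨ha, fun c hc hc' => ?_⟩)
        exact absurd hc' ((hcon c).2 hc))
  let X : ℕ → ℕ := fun i => i.rec x fun _ c => f c
  have hX : IsSigmaFun 3 X := by
    have h₂ : IsSigmaFun 3 fun x : ℕ × ℕ × ℕ => f x.2.2 :=
      hf.comp (.of_computable (Computable.snd.comp Computable.snd))
    have h₃ : IsSigmaFun 3 fun x : ℕ × ℕ => X x.2 :=
      IsSigmaFun.nat_rec (F := fun _ i => X i) (.of_computable (.const x)) h₂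
        (fun _ => rfl) fun _ _ => rfl
    exact h₃.comp (.of_computable (Computable.id.pair Computable.id))
  have hXinf : ∀ i, InfiniteAbove L (X i) ∧ L x (X i) := fun i => by
    induction i with
    | zero => exact ⟨hx, hxx⟩
    | succ i ih =>
      have := (hf' (X i)).resolve_left (by tauto)
      exact ⟨this.2, hL.trans ih.2 this.1.1⟩
  have hchild : ∀ i, IsChild L (X i) (X (i + 1)) := fun i =>
    ((hf' (X i)).resolve_left (by have := hXinf i; tauto)).1
  have hmono : ∀ {i j}, i ≤ j → L (X i) (X j) := fun {i j} hij => by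
    induction hij with
    | refl => exact hL.right (hXinf i).2
    | step _ ih => exact hL.trans ih (hchild _).1
  have hinj : Function.Injective X := by
    have : StrictMono fun i => {b | L b (X i)}.ncard := strictMono_nat_of_lt_succ fun i =>
      hL.ncard_below_lt (hchild i).1 (hchild i).2.1
    intro i j hij
    exact this.injective (by simp only [hij])
  have hXD : IsSigmaFun 3 fun i : ℕ => (X i, X (i + 1)) :=
    hX.pair (hX.comp (.of_computable Computable.succ))
  have hXD' : IsSigmaFun 3 fun y : ℕ × ℕ => ((X y.1, X (y.1 + 1)), y.2) :=
    (hXD.comp (.of_computable Computable.fst)).pair (.of_computable Computable.snd)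
  have c₁ : Computable fun y : (ℕ × ℕ) × ℕ => y.1.1 := Computable.fst.comp Computable.fst
  have c₂ : Computable fun y : (ℕ × ℕ) × ℕ => y.1.2 := Computable.snd.comp Computable.fst
  obtain ⟨M, hM, hM'⟩ := IsSigma.exists_isSigmaFun (n := 2)
    (p := fun i m => ∀ a, (¬ L (X i) a ∨ L (X (i + 1)) a) ∨ a < m) (by
      have c₁' : Computable fun y : ((ℕ × ℕ) × ℕ) × ℕ => y.1.1.1 := c₁.comp Computable.fst
      have c₂' : Computable fun y : ((ℕ × ℕ) × ℕ) × ℕ => y.1.1.2 := c₂.comp Computable.fst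
      have h₁ : IsSigma 0 fun y : ((ℕ × ℕ) × ℕ) × ℕ =>
          (¬ L y.1.1.1 y.2 ∨ L y.1.1.2 y.2) ∨ y.2 < y.1.2 :=
        ((hL.isSigma_not c₁' Computable.snd).or (hL.isSigma c₂' Computable.snd)).or
          (.of_computablePred (.lt' Computable.snd (Computable.snd.comp Computable.fst)))
      exact IsSigmaFun.subst (IsSigma.all (p := fun (y : (ℕ × ℕ) × ℕ) a =>
        (¬ L y.1.1 a ∨ L y.1.2 a) ∨ a < y.2) h₁).succ hXD')
    (fun i => by
      obtain ⟨b, hb⟩ := (hL.finite_above_diff (hfin (X i))).bddAbove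
      refine ⟨b + 1, fun a => or_iff_not_imp_left.2 fun ha => Nat.lt_succ_of_le (hb ?_)⟩
      push Not at ha
      refine ⟨ha.1, fun c hc hc' hca => ha.2 ?_⟩
      have hcX : c = X (i + 1) := by
        rcases hchain c _ hc' (hXinf (i + 1)).1 (hL.trans (hXinf i).2 hc.1) (hXinf (i + 1)).2
          with hl | hl
        · exact isChild_eq_of_le hc (hchild i) hl
        · exact (isChild_eq_of_le (hchild i) hc hl).symm
      exact hcX ▸ hca)
  have hout : ∀ n, (∀ i, ¬ (L (X i) n ∧ ¬ L (X (i + 1)) n)) ↔ ¬ L x n := by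
    refine fun n => ⟨fun ho hn => ?_, fun hn i hi => hn (hL.trans (hXinf i).2 hi.1)⟩
    refine Set.infinite_of_injective_forall_mem hinj (fun i => ?_) (hL.finite_below n)
    induction i with
    | zero => exact hn
    | succ i ih => exact not_not.1 fun h => ho i ⟨ih, h⟩
  have hseq : IsPieceSequence L (fun i a => L (X i) a ∧ ¬ L (X (i + 1)) a) X M True := by
    refine ⟨IsSigmaFun.subst (p := fun y : (ℕ × ℕ) × ℕ => L y.1.1 y.2 ∧ ¬ L y.1.2 y.2)
        ((hL.isSigma c₁ Computable.snd).and (hL.isSigma_not c₂ Computable.snd)) hXD',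
      (IsSigmaFun.subst (p := fun y : (ℕ × ℕ) × ℕ => ¬ L y.1.1 y.2 ∨ L y.1.2 y.2)
        ((hL.isSigma_not c₁ Computable.snd).or (hL.isSigma c₂ Computable.snd)) hXD').of_eq
          fun y => by tauto, hX, hM, ?_,
      fun i a ha => (hM' i a).resolve_left (by tauto), fun i => ⟨hmono le_rfl, fun h =>
        (hchild i).2.1 (hL.antisymm (hchild i).1 h)⟩,
      fun i a ha => ha.1, fun i j a b hij ha hb => ?_, fun i j a b hij ha hb hba => ?_,
      fun n _ ho i a ha => ?_, fun n _ ho i a ha han => ?_⟩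
    · refine ((hL.isSigma Computable.id Computable.id).and
        (hL.isSigma_not (.const x) Computable.id)).of_eq fun n => ?_
      rw [hout n]
      rfl
    · have hb' := hL.trans (hmono hij) hb.1
      refine ⟨fun hab => ⟨trivial, ?_⟩, ?_⟩
      · have hl := (hL.linear_below hab hb').resolve_right ha.2
        refine ((hchild i).2.2 a ha.1 hl).resolve_right ?_
        rintro rfl
        exact ha.2 hl
      · rintro ⟨-, rfl⟩
        exact hL.trans (hchild i).1 hb'
    · exact ha.2 (hL.trans (hL.trans (hmono hij) hb.1) hba)
    · rw [hout n] at ho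
      have hxa := hL.trans (hXinf i).2 ha.1
      exact ⟨fun h => (hL.linear_below h hxa).resolve_right ho, fun h => hL.trans h hxa⟩
    · exact (hout n).1 ho (hL.trans (hL.trans (hXinf i).2 ha.1) han)
  exact hseq.hasSigmaSelfEmbedding hL

/-- If the nodes with infinitely many nodes above them branch everywhere, then there is room for
every computable tree above any of them, and `0''` finds an embedding. -/
theorem hasSigmaSelfEmbedding_of_branching (hL : IsComputableTreeRel L)
    (hinf : {n | L n n}.Infinite)
    (hbr : ∀ x, InfiniteAbove L x → ∃ y z, InfiniteAbove L y ∧ InfiniteAbove L z ∧ L x y ∧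
      L x z ∧ ¬ L y z ∧ ¬ L z y) : HasSigmaSelfEmbedding L := by
  obtain ⟨root, hrr, hroot⟩ := hL.exists_root
  have hrinf : InfiniteAbove L root := hinf.mono fun n hn => hroot n hn
  obtain ⟨s, hs, hs'⟩ := IsSigma.exists_isSigmaFun (n := 2)
    (p := fun x (y : ℕ × ℕ) => ¬ InfiniteAbove L x ∨ (InfiniteAbove L y.1 ∧ InfiniteAbove L y.2 ∧
      L x y.1 ∧ L x y.2 ∧ ¬ L y.1 y.2 ∧ ¬ L y.2 y.1)) (by
      have c₁ : Computable fun x : ℕ × ℕ × ℕ => x.2.1 := Computable.fst.comp Computable.snd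
      have c₂ : Computable fun x : ℕ × ℕ × ℕ => x.2.2 := Computable.snd.comp Computable.snd
      exact (hL.isSigma_not_infiniteAbove.comp Computable.fst).or
        ((hL.isSigma_infiniteAbove.comp c₁).and ((hL.isSigma_infiniteAbove.comp c₂).and
        ((hL.isSigma Computable.fst c₁).and ((hL.isSigma Computable.fst c₂).and
        ((hL.isSigma_not c₁ c₂).and (hL.isSigma_not c₂ c₁)))))))
    (fun x => by
      by_cases hx : InfiniteAbove L x
      · obtain ⟨y, z, h⟩ := hbr x hx
        exact ⟨(y, z), .inr h⟩
      · exact ⟨(0, 0), .inl hx⟩)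
  have hspec := fun {x} (hx : InfiniteAbove L x) => (hs' x).resolve_left (not_not.2 hx)
  let b : ℕ → ℕ := fun x => (s x).2
  -- the nodes `g u k`, for `k : ℕ`, form an antichain above `u`
  let g : ℕ → ℕ → ℕ := fun u k => (s (b^[k] u)).1
  have hb : IsSigmaFun 3 b := (IsSigmaFun.of_computable Computable.snd).comp hs
  have hg : IsSigmaFun 3 fun x : ℕ × ℕ => g x.1 x.2 := by
    have h₁ : IsSigmaFun 3 fun x : ℕ × ℕ × ℕ => b x.2.2 :=
      hb.comp (.of_computable (Computable.snd.comp Computable.snd))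
    have h₂ : IsSigmaFun 3 fun x : ℕ × ℕ => b^[x.2] x.1 :=
      IsSigmaFun.nat_rec (F := fun u k => b^[k] u) (.of_computable Computable.id) h₁
        (fun _ => rfl) fun _ _ => Function.iterate_succ_apply' _ _ _
    exact (IsSigmaFun.of_computable Computable.fst).comp (hs.comp h₂)
  have hbk : ∀ {u} k, InfiniteAbove L u → InfiniteAbove L (b^[k] u) := fun {u} k hu => by
    induction k with
    | zero => exact hu
    | succ k ih =>
      rw [Function.iterate_succ_apply']
      exact (hspec ih).2.1
  have hself : ∀ {u}, InfiniteAbove L u → L u u := fun hu => hL.left (hspec hu).2.2.1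
  have hbmono : ∀ {u k k'}, InfiniteAbove L u → k ≤ k' → L (b^[k] u) (b^[k'] u) :=
    fun {u k k'} hu hk => by
      induction hk with
      | refl => exact hself (hbk k hu)
      | @step m _ ih =>
        rw [Function.iterate_succ_apply']
        exact hL.trans ih (hspec (hbk m hu)).2.2.2.1
  have hginf : ∀ {u} k, InfiniteAbove L u → InfiniteAbove L (g u k) := fun k hu =>
    (hspec (hbk k hu)).1
  have hgle : ∀ {u} k, InfiniteAbove L u → L u (g u k) := fun {u} k hu =>
    hL.trans (hbmono (k := 0) hu (Nat.zero_le k)) (hspec (hbk k hu)).2.2.1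
  have hgne : ∀ {u} k, InfiniteAbove L u → g u k ≠ u := fun {u} k hu heq => by
    have h₁ := hbmono (k := 0) hu (Nat.zero_le k)
    have h₂ := hspec (hbk k hu)
    refine h₂.2.2.2.2.1 (hL.trans ?_ h₂.2.2.2.1)
    rw [show (s (b^[k] u)).1 = u from heq]
    exact h₁
  have hganti : ∀ {u k k' w}, InfiniteAbove L u → k < k' → L (g u k) w → L (g u k') w → False :=
    fun {u k k' w} hu hk h₁ h₂ => by
      have h := hspec (hbk k hu)
      have h₃ : L (s (b^[k] u)).2 (g u k') := by
        have := hbmono hu (Nat.succ_le_of_lt hk)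
        rw [Function.iterate_succ_apply'] at this
        exact hL.trans this (hspec (hbk k' hu)).2.2.1
      exact (hL.linear_below h₁ (hL.trans h₃ h₂)).elim h.2.2.2.2.1 h.2.2.2.2.2
  have hganti' : ∀ {u k k' w}, InfiniteAbove L u → L (g u k) w → L (g u k') w → k = k' :=
    fun {u k k' w} hu h₁ h₂ => by
      rcases lt_trichotomy k k' with hk | hk | hk
      · exact (hganti hu hk h₁ h₂).elim
      · exact hk
      · exact (hganti hu hk h₂ h₁).elim
  let Step : ℕ × ℕ → ℕ × ℕ → Prop := fun x y => IsChild L x.1 y.1 ∧ g x.2 y.1 = y.2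
  have hStep : IsSigma 3 fun x : (ℕ × ℕ) × ℕ × ℕ => Step x.1 x.2 := by
    have c₁ : Computable fun x : (ℕ × ℕ) × ℕ × ℕ => (x.1.1, x.2.1) :=
      (Computable.fst.comp Computable.fst).pair (Computable.fst.comp Computable.snd)
    have c₂ : Computable fun x : (ℕ × ℕ) × ℕ × ℕ => ((x.1.2, x.2.1), x.2.2) :=
      ((Computable.snd.comp Computable.fst).pair (Computable.fst.comp Computable.snd)).pair
        (Computable.snd.comp Computable.snd)
    have h₁ : IsSigma 3 fun x : (ℕ × ℕ) × ℕ × ℕ => g x.1.2 x.2.1 = x.2.2 := IsSigma.comp hg c₂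
    exact (hL.isSigma_isChild.comp c₁).and h₁
  -- the recursion `f root = u₀`, `f c = g (f p) c` for a child `c` of `p`
  let u₀ := g root 0
  let F : ℕ → ℕ → Prop := fun n v => Relation.ReflTransGen Step (root, u₀) (n, v)
  have hF : ∀ n, ∃ v, L n n → ∀ w, F n w ↔ w = v := by
    intro n
    by_cases hn : L n n
    swap
    · exact ⟨0, fun h => absurd h hn⟩
    refine hL.tree_induction hroot (P := fun n => ∃ v, L n n → ∀ w, F n w ↔ w = v) ?_ ?_ hn
    · refine ⟨u₀, fun _ w => ⟨fun h => ?_, fun h => h ▸ .refl⟩⟩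
      rcases Relation.ReflTransGen.cases_tail h with h | ⟨⟨p, v⟩, -, h⟩
      · exact congrArg Prod.snd h
      · exact absurd (hL.antisymm h.1.1 (hroot p (hL.left h.1.1))) h.1.2.1
    · rintro p c hpc ⟨v, hv⟩
      have hv := hv (hL.left hpc.1)
      refine ⟨g v c, fun _ w => ⟨fun h => ?_, fun h => ?_⟩⟩
      · rcases Relation.ReflTransGen.cases_tail h with h | ⟨⟨p', v'⟩, h', h⟩
        · have hc : c = root := congrArg Prod.fst h
          subst hc
          exact absurd (hL.antisymm hpc.1 (hroot p (hL.left hpc.1))) hpc.2.1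
        · obtain rfl := hL.parent_unique hpc h.1
          obtain rfl := (hv v').1 h'
          exact h.2.symm
      · exact Relation.ReflTransGen.tail ((hv v).2 rfl) ⟨hpc, h.symm⟩
  choose f hf using hF
  have hfroot : f root = u₀ := ((hf root hrr u₀).1 .refl).symm
  have hfchild : ∀ {p c}, IsChild L p c → f c = g (f p) c := fun {p c} hpc =>
    ((hf c (hL.right hpc.1) _).1
      (Relation.ReflTransGen.tail ((hf p (hL.left hpc.1) _).2 rfl) ⟨hpc, rfl⟩)).symm
  have hfinf : ∀ {n}, L n n → InfiniteAbove L (f n) ∧ L u₀ (f n) := fun {n} hn => by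
    refine hL.tree_induction hroot (P := fun n => InfiniteAbove L (f n) ∧ L u₀ (f n)) ?_ ?_ hn
    · rw [hfroot]
      exact ⟨hginf 0 hrinf, hself (hginf 0 hrinf)⟩
    · rintro p c hpc ⟨h₁, h₂⟩
      rw [hfchild hpc]
      exact ⟨hginf c h₁, hL.trans h₂ (hgle c h₁)⟩
  have hflt : ∀ {p c}, IsChild L p c → L (f p) (f c) ∧ f p ≠ f c := fun {p c} hpc => by
    have hp := (hfinf (hL.left hpc.1)).1
    rw [hfchild hpc]
    exact ⟨hgle c hp, (hgne c hp).symm⟩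
  have hfmono : ∀ {n m}, L n m → L (f n) (f m) := fun {n m} hnm => by
    refine hL.tree_induction hroot (P := fun m => L n m → L (f n) (f m)) ?_ ?_ (hL.right hnm) hnm
    · intro h
      rw [hL.antisymm h (hroot n (hL.left h))]
      exact hself (hfinf hrr).1
    · intro p c hpc ih hnc
      by_cases hne : n = c
      · exact hne ▸ hself (hfinf (hL.left hnc)).1
      · refine hL.trans (ih ?_) (hflt hpc).1
        rcases hL.linear_below hnc hpc.1 with hl | hl
        · exact hl
        · rcases hpc.2.2 n hl hnc with rfl | rfl
          · exact hl
          · exact absurd rfl hne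
  have hfinj : ∀ {n m}, L n m → L (f m) (f n) → n = m := fun {n m} hnm h => by
    by_contra hne
    obtain ⟨c, hc, hcm⟩ := hL.exists_isChild_le hnm hne
    exact (hflt hc).2 (hL.antisymm (hflt hc).1 (hL.trans (hfmono hcm) h))
  -- nodes whose images lie below a common node `w` are comparable: otherwise the images of the
  -- children of their meet would both lie below `w`
  have hfcomp : ∀ {n m w}, L n n → L m m → L (f n) w → L (f m) w → L n m ∨ L m n := by
    intro n m w hn hm hnw hmw
    refine hL.tree_induction hroot (P := fun n => L (f n) w → L n m ∨ L m n) ?_ ?_ hn hnw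
    · exact fun _ => .inl (hroot m hm)
    · intro p c hpc ih hcw
      rcases ih (hL.trans (hflt hpc).1 hcw) with h | h
      · by_cases hne : p = m
        · exact .inr (hne ▸ hpc.1)
        · obtain ⟨c', hc', hcm⟩ := hL.exists_isChild_le h hne
          have h₁ := hL.trans (hfmono hcm) hmw
          rw [hfchild hc'] at h₁
          rw [hfchild hpc] at hcw
          obtain rfl := hganti' (hfinf (hL.left hpc.1)).1 hcw h₁
          exact .inl hcm
      · exact .inr (hL.trans h hpc.1)
  refine ⟨f, fun n hn => hself (hfinf hn).1, fun n m hn hm => ⟨hfmono, fun h => ?_⟩,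
    ⟨root, hrr, fun n hn h => ?_⟩, ?_⟩
  · rcases hfcomp hn hm h (hself (hfinf hm).1) with hl | hl
    · exact hl
    · rw [hfinj hl h]
      exact hn
  · have h₁ := (hfinf hn).2
    rw [h] at h₁
    exact hgne 0 hrinf (hL.antisymm h₁ (hgle 0 hrinf))
  · have h₁ : IsSigma 3 fun x : ℕ × ℕ => F x.1 x.2 :=
      hStep.reflTransGen.comp ((Computable.const (root, u₀)).pair Computable.id)
    refine ((hL.isSigma Computable.fst Computable.fst).and h₁).of_eq fun x => ?_
    exact and_congr_right fun hx => (hf _ hx _).trans eq_comm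

end IsComputableTreeRel

theorem theorem2p3 (T : Set ℕ) (r : T → T → Prop) (hT : IsComputableTree T r)
    (hinf : T.Infinite) :
    ∃ f : r ↪r r, ¬ Function.Surjective f ∧
      IsComputableFrom (turingJump (turingJump ∅)) T f := by
  have hL := hT.isComputableTreeRel
  refine HasSigmaSelfEmbedding.exists_isComputableFrom hT.isTree ?_
  by_cases h₁ : ∀ y, {c | IsChild (natRel T r) y c ∧ ¬ InfiniteAbove (natRel T r) c}.Finite
  · by_cases h₂ : ∃ x, InfiniteAbove (natRel T r) x ∧ ∀ y z, InfiniteAbove (natRel T r) y →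
        InfiniteAbove (natRel T r) z → natRel T r x y → natRel T r x z →
        natRel T r y z ∨ natRel T r z y
    · obtain ⟨x, hx, hchain⟩ := h₂
      exact hL.hasSigmaSelfEmbedding_of_chain h₁ hx hchain
    · refine hL.hasSigmaSelfEmbedding_of_branching ?_ fun x hx => ?_
      · exact hinf.mono fun n hn => (natRel_self hT.isTree).2 hn
      · by_contra! hcon
        refine h₂ ⟨x, hx, fun y z hy hz hxy hxz => or_iff_not_imp_left.2 fun h => ?_⟩
        exact hcon y z hy hz hxy hxz h
  · push Not at h₁
    obtain ⟨x, hx⟩ := h₁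
    exact hL.hasSigmaSelfEmbedding_of_infinite_children hx
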